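/- **Theorem.** In the *localization game with $k$ sensors* on a finite graph $G=(V,E)$, in each round the cops choose a set $S\subseteq V$ with $|S|=k$, the invisible robber chooses her position (any vertex in the first round; in later rounds her previous position or one of its neighbours), and the cops learn the distances from each $s\in S$ to the robber's position. The cops win in a round if the information received so far determines the robber's position in that round, i.e. if all trajectories of the robber consistent with that information are at the same vertex in that round. The localization number $\zeta(G)$ is the least $k$ such that the cops can win in finite time regardless of the strategy of the robber. Let $p=p(n)\in[0,1]$, let $d=pn$ with $\log^3 n\ll d\ll n$, let $i=i(n)$ be non-negative integers, and let $c=c(n)=d^i/n$. (In each of the cases below, $i$ is, for all large $n$, the largest integer with $d^i\le 3n\log n$.) Then the following holds for the binomial random graph $\mathcal G(n,p)$, where all limits are as $n\to\infty$ and "a.a.s." means with probability tending to $1$. (i) If $c\to A$ for a real number $A>0$, then a.a.s. $$\zeta(\mathcal G(n,p))\le(1+o(1))(\log d+2\log\log n)\,\frac{e^A}{1-e^{-A}}.$$ (ii) If $c\to\infty$ and $c-(\log d-\log\log d)\to-\infty$, then a.a.s. $$\zeta(\mathcal G(n,p))\le(1+o(1))(\log d+2\log\log n)\,e^c.$$ (iii)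 If $c-(\log d-\log\log d)\to B\in\mathbb R$, then a.a.s. $$\zeta(\mathcal G(n,p))\le(1+o(1))(\log d+2\log\log n)\,\frac{e^c}{e^B+1},\qquad\text{where}\qquad (\log d+2\log\log n)\,\frac{e^c}{e^B+1}\sim(\log d+2\log\log n)\,\frac{n}{d^{i-1}(1+e^{-B})};$$ consequently, a.a.s. also $$\zeta(\mathcal G(n,p))\le(1+o(1))(\log d+2\log\log n)\,\frac{n}{d^{i-1}(1+e^{-B})}.$$ (iv) If $c-(\log d-\log\log d)\to\infty$ and $c\le 3\log n$ for all large $n$, then a.a.s. $$\zeta(\mathcal G(n,p))\le(1+o(1))(\log d+2\log\log n)\,\frac{n}{d^{i-1}}.$$ -/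

import Mathlib

open Filter Topology Asymptotics

noncomputable section

namespace LocalizationGame

variable {V : Type*}

/-- The `S`-signature of the vertex `v`: the distances from the sensors in `S` to `v`, recorded as a
function on `V` that is undefined (`none`) at the vertices carrying no sensor. Distances are the
extended graph distances, so that they also make sense in disconnected graphs. -/
def signature (G : SimpleGraph V) (S : Finset V) (v : V) : V → Option ℕ∞ :=
  open Classical in fun s => if s ∈ S then some (G.edist s v) else none

/-- A trajectory of the robber: in each round she stays where she is or moves to a neighbour. -/
def IsRobberWalk (G : SimpleGraph V) (v : ℕ → V) : Prop :=
  ∀ t, v (t + 1) = v t ∨ G.Adj (v t) (v (t + 1))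

/-- A strategy of the cops with `k` sensors: the set of `k` sensor locations to be used next, as a
function of the signatures received so far. -/
def CopStrategy (V : Type*) (k : ℕ) : Type _ :=
  List (V → Option ℕ∞) → {S : Finset V // S.card = k}

/-- The info trail: the list of the signatures received by the cops in the first `t` rounds (rounds
are numbered from `0`) if they play by `σ` and the robber is at `v j` in round `j`. -/
def infoTrail (G : SimpleGraph V) {k : ℕ} (σ : CopStrategy V k) (v : ℕ → V) :
    ℕ → List (V → Option ℕ∞)
  | 0 => []
  | t + 1 => infoTrail G σ v t ++ [signature G (σ (infoTrail G σ v t)).1 (v t)]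

/-- Playing by `σ` against the trajectory `v`, the cops win in round `t`: every trajectory with the
same info trail, up to and including round `t`, is at the same vertex in round `t`. -/
def CopsWinInRound (G : SimpleGraph V) {k : ℕ} (σ : CopStrategy V k) (v : ℕ → V) (t : ℕ) : Prop :=
  ∀ w : ℕ → V, IsRobberWalk G w → infoTrail G σ w (t + 1) = infoTrail G σ v (t + 1) → w t = v t

/-- The cops can win the localization game with `k` sensors in finite time, whatever the robber
does. -/
def CopsCanWin (G : SimpleGraph V) (k : ℕ) : Prop :=
  ∃ σ : CopStrategy V k, ∀ v : ℕ → V, IsRobberWalk G v → ∃ t, CopsWinInRound G σ v t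

/-- The localization number `ζ(G)`: the least number of sensors with which the cops can win. On a
finite graph such a number exists, as a sensor on every vertex wins at once. -/
def localizationNumber (G : SimpleGraph V) : ℕ :=
  sInf {k | CopsCanWin G k}

/-- The property `Q` holds asymptotically almost surely for the binomial random graph on `n`
vertices with edge probability `p n`. -/
def AAS (p : ℕ → unitInterval) (Q : ∀ n, SimpleGraph (Fin n) → Prop) : Prop :=
  Tendsto (fun n => SimpleGraph.binomialRandom (Fin n) (p n) {G | Q n G}) atTop (𝓝 1)

/-- A.a.s. `ζ(G) ≤ (1 + o(1)) f(n)` for the binomial random graph `G`. -/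
def AASLocalizationLE (p : ℕ → unitInterval) (f : ℕ → ℝ) : Prop :=
  ∃ ε : ℕ → ℝ, Tendsto ε atTop (𝓝 0) ∧
    AAS p fun n G => (localizationNumber G : ℝ) ≤ (1 + ε n) * f n

end LocalizationGame

end

/-! The cops keep track of the set `B` of vertices still compatible with the signatures received.
Suppose that closed neighbourhoods have at most `D` vertices and that every two vertices are
distinguished by at least `q n` sensor locations. If the last signature class had `a` elements, then
`|B| ≤ D a`. Random sensors leave on average at most `|B|² e^{-qk}` ordered pairs of `B` confused,
while a signature class of size `x` contributes `x (x - 1)` such pairs. When `D² e^{-qk} < 1/2`,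
this is incompatible with `x ≥ a` and `x ≥ 2`, so the classes shrink until one is a singleton
(`localizationNumber_le_of_distinguishing`). With `D` of order `d`, about `2 log d / q` sensors are
enough; the term `2 log log n` of the theorem is slack.

It remains to show that a.a.s. every pair is distinguished by about `2 ρ n` sensors, where `ρ =
e^{-c} (1 - e^{-c}) + c / d`. The second term comes from balls of radius `i - 1`: they have about
`d^{i-1} = (c / d) n` vertices, and those around `u` and `v` are almost disjoint because small sets
expand by a factor of about `d` (`Regime.card_ballDiff_ge`). The first term, used for `c ≤ log d`,
comes from spheres of radius `i`: once the balls of radius `i - 1` are revealed, a vertex outside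
them has no neighbour in the outer layer of `u` with probability about `e^{-c}` and has one in that
of `v` with probability about `1 - e^{-c}`, and the edges concerned are still unexposed
(`measure_card_freshSphere_le`). Exchanging `u` and `v` gives the factor 2
(`card_distinguishing_ge`).

Errors multiply over `i` levels of growth, so each level may lose only a factor `1 ± η / log n`;
Chernoff and union bounds then need `(η / log n)² d` to exceed a multiple of `log n`, which is what
`log³ n ≪ d` provides. In cases (i) and (ii) the first term of `ρ` suffices, in (iii) the two are
comparable, and in (iv) the second is used alone. -/

noncomputable section

namespace LocalizationGame

set_option linter.unusedSectionVars false

section General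

open scoped Classical

/-! ### The game: from distinguishing sets to a winning strategy. -/

section Game

variable {V : Type*} [Fintype V] [DecidableEq V]

/-- The closed neighbourhood of a set of vertices. -/
def expand (G : SimpleGraph V) (A : Finset V) : Finset V :=
  Finset.univ.filter fun w => w ∈ A ∨ ∃ a ∈ A, G.Adj a w

/-- The sensor locations that distinguish `u` from `v`. -/
def distinguishing (G : SimpleGraph V) (u v : V) : Finset V :=
  Finset.univ.filter fun s => G.edist s u ≠ G.edist s v

/-- The ordered pairs of distinct vertices of `B` that no sensor in `S` distinguishes. -/
def confusedPairs (G : SimpleGraph V) (B S : Finset V) : Finset (V × V) :=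
  B.offDiag.filter fun x => Disjoint S (distinguishing G x.1 x.2)

lemma mem_expand {G : SimpleGraph V} {A : Finset V} {w : V} :
    w ∈ expand G A ↔ w ∈ A ∨ ∃ a ∈ A, G.Adj a w := by
  simp [expand]

lemma subset_expand (G : SimpleGraph V) (A : Finset V) : A ⊆ expand G A :=
  fun _ hw => mem_expand.2 (Or.inl hw)

lemma edist_eq_of_signature_eq {G : SimpleGraph V} {S : Finset V} {x y s : V}
    (h : signature G S x = signature G S y) (hs : s ∈ S) : G.edist s x = G.edist s y := by
  have := congrFun h s
  simpa [signature, hs] using this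

lemma disjoint_distinguishing_of_signature_eq {G : SimpleGraph V} {S : Finset V} {x y : V}
    (h : signature G S x = signature G S y) : Disjoint S (distinguishing G x y) := by
  rw [Finset.disjoint_left]
  intro s hs
  simp [distinguishing, edist_eq_of_signature_eq h hs]

lemma confusedPairs_anti (G : SimpleGraph V) (B : Finset V) {S T : Finset V} (h : S ⊆ T) :
    confusedPairs G B T ⊆ confusedPairs G B S := by
  intro x hx
  simp only [confusedPairs, Finset.mem_filter] at hx ⊢
  exact ⟨hx.1, hx.2.mono_left h⟩

/-- First moment method: `k` independent uniform sensors, repetitions allowed, all miss a given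
distinguishing set with probability at most `(1 - q)^k ≤ e^{-qk}`. Some choice does at least as well
as the average. -/
lemma exists_card_confusedPairs_le [Nonempty V] (G : SimpleGraph V) {q : ℝ} {k : ℕ}
    (hk : k ≤ Fintype.card V)
    (hq : ∀ u v, u ≠ v → q * Fintype.card V ≤ (distinguishing G u v).card) (B : Finset V) :
    ∃ S : Finset V, S.card = k ∧
      ((confusedPairs G B S).card : ℝ) ≤ (B.card : ℝ) ^ 2 * Real.exp (-(q * k)) := by
  set n := Fintype.card V with hn
  have hn0 : (0 : ℝ) < n := by exact_mod_cast Fintype.card_pos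
  have hpair : ∀ x ∈ B.offDiag,
      ((Finset.univ.filter fun f : Fin k → V =>
        ∀ j, f j ∉ distinguishing G x.1 x.2).card : ℝ) ≤ Real.exp (-(q * k)) * (n : ℝ) ^ k := by
    intro x hx
    have hne : x.1 ≠ x.2 := (Finset.mem_offDiag.1 hx).2.2
    have hcard : (Finset.univ.filter fun f : Fin k → V =>
        ∀ j, f j ∉ distinguishing G x.1 x.2).card = (n - (distinguishing G x.1 x.2).card) ^ k := by
      have : (Finset.univ.filter fun f : Fin k → V => ∀ j, f j ∉ distinguishing G x.1 x.2)
          = Fintype.piFinset fun _ : Fin k => (distinguishing G x.1 x.2)ᶜ := by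
        ext f; simp
      rw [this, Fintype.card_piFinset]
      simp [Finset.card_compl, hn]
    rw [hcard]
    have hle : (distinguishing G x.1 x.2).card ≤ n := Finset.card_le_univ _
    push_cast [Nat.cast_sub hle]
    have h1 : (n : ℝ) - (distinguishing G x.1 x.2).card ≤ Real.exp (-q) * n := by
      have := hq _ _ hne
      have := Real.add_one_le_exp (-q)
      nlinarith
    have h0 : (0 : ℝ) ≤ (n : ℝ) - (distinguishing G x.1 x.2).card := by
      rw [sub_nonneg]; exact_mod_cast hle
    calc _ ≤ (Real.exp (-q) * n) ^ k := pow_le_pow_left₀ h0 h1 k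
      _ = _ := by rw [mul_pow, ← Real.exp_nat_mul]; congr 2; ring
  have hsum : ∑ f : Fin k → V,
      ((B.offDiag.filter fun x => ∀ j, f j ∉ distinguishing G x.1 x.2).card : ℝ)
        ≤ ∑ _f : Fin k → V, (B.card : ℝ) ^ 2 * Real.exp (-(q * k)) := by
    have hswap : ∑ f : Fin k → V,
        ((B.offDiag.filter fun x => ∀ j, f j ∉ distinguishing G x.1 x.2).card : ℝ)
        = ∑ x ∈ B.offDiag, ((Finset.univ.filter fun f : Fin k → V =>
            ∀ j, f j ∉ distinguishing G x.1 x.2).card : ℝ) := by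
      simp only [Finset.card_filter, Nat.cast_sum]
      exact Finset.sum_comm
    rw [hswap]
    calc _ ≤ ∑ _x ∈ B.offDiag, Real.exp (-(q * k)) * (n : ℝ) ^ k := Finset.sum_le_sum hpair
      _ = (B.offDiag.card : ℝ) * (Real.exp (-(q * k)) * (n : ℝ) ^ k) := by simp
      _ ≤ (B.card : ℝ) ^ 2 * (Real.exp (-(q * k)) * (n : ℝ) ^ k) := by
          gcongr
          have : B.offDiag.card ≤ B.card ^ 2 := by
            rw [Finset.offDiag_card, sq]; exact Nat.sub_le _ _
          exact_mod_cast this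
      _ = _ := by simp [hn]; ring
  obtain ⟨f, -, hf⟩ := Finset.exists_le_of_sum_le Finset.univ_nonempty hsum
  -- Repetitions may leave fewer than `k` locations; adding sensors can only reduce confusion.
  have himg : (Finset.univ.image f).card ≤ k := by
    simpa using (Finset.card_image_le (s := Finset.univ) (f := f))
  obtain ⟨S, hS, hSk⟩ := Finset.exists_superset_card_eq himg hk
  refine ⟨S, hSk, le_trans ?_ hf⟩
  have hsub : confusedPairs G B S ⊆
      B.offDiag.filter fun x => ∀ j, f j ∉ distinguishing G x.1 x.2 := by
    refine (confusedPairs_anti G B hS).trans fun x hx => ?_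
    simp only [confusedPairs, Finset.mem_filter] at hx ⊢
    exact ⟨hx.1, fun j => Finset.disjoint_left.1 hx.2 (by simp)⟩
  exact_mod_cast Finset.card_le_card hsub

/-- The vertices of `B` with the same `S`-signature as `x`. -/
def signatureClass (G : SimpleGraph V) (B S : Finset V) (s : V → Option ℕ∞) : Finset V :=
  B.filter fun y => signature G S y = s

lemma card_signatureClass_mul_le (G : SimpleGraph V) (B S : Finset V) (s : V → Option ℕ∞) :
    (signatureClass G B S s).card * ((signatureClass G B S s).card - 1)
      ≤ (confusedPairs G B S).card := by
  rw [Nat.mul_sub_one, ← Finset.offDiag_card]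
  refine Finset.card_le_card fun x hx => ?_
  simp only [signatureClass, confusedPairs, Finset.mem_offDiag, Finset.mem_filter] at hx ⊢
  exact ⟨⟨hx.1.1, hx.2.1.1, hx.2.2⟩,
    disjoint_distinguishing_of_signature_eq (hx.1.2.trans hx.2.1.2.symm)⟩

/-- Equal trails before round `t` make the strategy place the same sensors in round `t`, so the last
signatures are comparable. -/
lemma infoTrail_succ_inj {G : SimpleGraph V} {k : ℕ} {σ : CopStrategy V k} {v w : ℕ → V} {t : ℕ}
    (h : infoTrail G σ w (t + 1) = infoTrail G σ v (t + 1)) :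
    infoTrail G σ w t = infoTrail G σ v t ∧
      signature G (σ (infoTrail G σ v t)).1 (w t) = signature G (σ (infoTrail G σ v t)).1 (v t) := by
  simp only [infoTrail] at h
  obtain ⟨h1, h2⟩ := List.append_inj' h rfl
  refine ⟨h1, ?_⟩
  rw [h1] at h2
  simpa using h2

/-- If the sensors can always be placed so that the set of candidates shrinks, the cops win. -/
lemma copsCanWin_of_shrinking (G : SimpleGraph V) {k : ℕ} {D : ℕ}
    (hD : ∀ A : Finset V, (expand G A).card ≤ D * A.card)
    (hS : ∀ B : Finset V, ∃ S : Finset V, S.card = k ∧ ∀ a : ℕ, B.card ≤ D * a →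
      ∀ s, 1 < (signatureClass G B S s).card → (signatureClass G B S s).card < a) :
    CopsCanWin G k := by
  choose S hSk hS using hS
  -- The sensors depend only on the candidate set, which is a fold over the received signatures;
  -- this makes `σ` a legitimate strategy. The size `a` of the previous class is not needed to
  -- choose them.
  let step : Finset V → (V → Option ℕ∞) → Finset V :=
    fun B s => expand G (signatureClass G B (S B) s)
  let σ : CopStrategy V k := fun l => ⟨S (l.foldl step Finset.univ), hSk _⟩
  let cand : (ℕ → V) → ℕ → Finset V := fun v t => (infoTrail G σ v t).foldl step Finset.univ
  let cls : (ℕ → V) → ℕ → Finset V := fun v t =>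
    signatureClass G (cand v t) (S (cand v t)) (signature G (S (cand v t)) (v t))
  have hsucc : ∀ v t, cand v (t + 1) = expand G (cls v t) := by
    intro v t
    simp only [cand, cls, infoTrail, List.foldl_append, List.foldl_cons, List.foldl_nil]
    rfl
  have hmem : ∀ v, IsRobberWalk G v → ∀ t, v t ∈ cand v t := by
    intro v hv t
    induction t with
    | zero => simp [cand, infoTrail]
    | succ t ih =>
      rw [hsucc, mem_expand]
      have hcl : v t ∈ cls v t := by simp [cls, signatureClass, ih]
      rcases hv t with h | h
      · left; rwa [h]
      · right; exact ⟨v t, hcl, h⟩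
  refine ⟨σ, fun v hv => ?_⟩
  -- In a round that is not won the class has at least two elements, so otherwise its size would
  -- decrease forever.
  by_contra! hcon
  have hbig : ∀ t, 1 < (cls v t).card := by
    intro t
    have := hcon t
    simp only [CopsWinInRound, not_forall] at this
    obtain ⟨w, hw, htr, hne⟩ := this
    obtain ⟨h1, h2⟩ := infoTrail_succ_inj htr
    have hcw : cand w t = cand v t := by simp only [cand, h1]
    rw [Finset.one_lt_card]
    refine ⟨w t, ?_, v t, ?_, hne⟩
    · have := hmem w hw t
      rw [hcw] at this
      simp only [cls, signatureClass, Finset.mem_filter]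
      exact ⟨this, h2⟩
    · simp [cls, signatureClass, hmem v hv t]
  have hdec : ∀ t, (cls v (t + 1)).card < (cls v t).card := by
    intro t
    refine hS (cand v (t + 1)) _ ?_ _ (hbig (t + 1))
    rw [hsucc]
    exact hD _
  have hbd : ∀ t, (cls v t).card + t ≤ (cls v 0).card := by
    intro t
    induction t with
    | zero => simp
    | succ t ih => have := hdec t; omega
  have := hbd ((cls v 0).card + 1)
  omega

lemma copsCanWin_card (G : SimpleGraph V) : CopsCanWin G (Fintype.card V) := by
  refine ⟨fun _ => ⟨Finset.univ, rfl⟩, fun v _ => ⟨0, fun w _ h => ?_⟩⟩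
  have := edist_eq_of_signature_eq (infoTrail_succ_inj h).2 (Finset.mem_univ (v 0))
  simp only [SimpleGraph.edist_self] at this
  exact (SimpleGraph.edist_eq_zero_iff.1 this).symm

lemma localizationNumber_le_of_distinguishing [Nonempty V] (G : SimpleGraph V) {q : ℝ} {k D : ℕ}
    (hD : ∀ A : Finset V, (expand G A).card ≤ D * A.card)
    (hq : ∀ u v, u ≠ v → q * Fintype.card V ≤ (distinguishing G u v).card)
    (hk : (D : ℝ) ^ 2 * Real.exp (-(q * k)) < 1 / 2) :
    localizationNumber G ≤ k := by
  -- More than `|V|` sensors cannot be placed, but the infimum is at most `|V|` in any case.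
  rcases le_total (Fintype.card V) k with hkn | hkn
  · exact (Nat.sInf_le (copsCanWin_card G)).trans hkn
  refine Nat.sInf_le (copsCanWin_of_shrinking G hD fun B => ?_)
  obtain ⟨S, hSk, hS⟩ := exists_card_confusedPairs_le G hkn hq B
  refine ⟨S, hSk, fun a ha s hs => ?_⟩
  set x := (signatureClass G B S s).card with hx
  by_contra! hax
  have h1 : (x : ℝ) * (x - 1) ≤ (confusedPairs G B S).card := by
    have := card_signatureClass_mul_le G B S s
    rw [← hx] at this
    have h2 : ((x * (x - 1) : ℕ) : ℝ) ≤ (confusedPairs G B S).card := by exact_mod_cast this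
    rwa [Nat.cast_mul, Nat.cast_sub hs.le, Nat.cast_one] at h2
  have h2 : (B.card : ℝ) ≤ D * x := by
    exact_mod_cast ha.trans (Nat.mul_le_mul_left D hax)
  have hx2 : (2 : ℝ) ≤ x := by exact_mod_cast hs
  have h3 : (B.card : ℝ) ^ 2 * Real.exp (-(q * k)) ≤ (x : ℝ) ^ 2 * (1 / 2) := by
    calc _ ≤ ((D : ℝ) * x) ^ 2 * Real.exp (-(q * k)) := by gcongr
      _ = (x : ℝ) ^ 2 * ((D : ℝ) ^ 2 * Real.exp (-(q * k))) := by ring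
      _ ≤ _ := by gcongr
  have h4 : (B.card : ℝ) ^ 2 * Real.exp (-(q * k)) < (x : ℝ) ^ 2 * (1 / 2) := by
    calc _ ≤ ((D : ℝ) * x) ^ 2 * Real.exp (-(q * k)) := by gcongr
      _ = (x : ℝ) ^ 2 * ((D : ℝ) ^ 2 * Real.exp (-(q * k))) := by ring
      _ < _ := by gcongr
  -- The bounds combine to `x (x - 1) < x² / 2`, that is `x < 2`.
  nlinarith

end Game

/-! ### Independence of events determined by disjoint sets of potential edges. -/

section Independence

open MeasureTheory ProbabilityTheory

variable {V : Type*} [Fintype V] [DecidableEq V] {p : unitInterval}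

lemma measurableSet_of_finite_graph (E : Set (SimpleGraph V)) : MeasurableSet E := by
  have h := (SimpleGraph.measurableEmbedding_edgeSet (V := V)).measurableSet_image
    (s := E)
  exact h.1 (Set.toFinite _).measurableSet

lemma measurable_of_finite_graph {α : Type*} [MeasurableSpace α] (f : SimpleGraph V → α) :
    Measurable f :=
  fun _ _ => measurableSet_of_finite_graph _

/-- The law of a single potential edge. -/
def edgeLaw (p : unitInterval) (e : Sym2 V) : Measure Prop :=
  unitInterval.toNNReal p • Measure.dirac (e ∈ Sym2.diagSetᶜ) +
    unitInterval.toNNReal (unitInterval.symm p) • Measure.dirac False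

/-- The graph with a given set of edges. -/
def graphOfEdges (ω : Sym2 V → Prop) : SimpleGraph V := SimpleGraph.fromEdgeSet {e | ω e}

instance (e : Sym2 V) : IsProbabilityMeasure (edgeLaw p e) := by
  unfold edgeLaw; infer_instance

lemma measurable_graphOfEdges : Measurable (graphOfEdges (V := V)) :=
  SimpleGraph.measurable_fromEdgeSet.comp MeasurableEquiv.setOfPred.measurable

lemma binomialRandom_eq_map_graphOfEdges :
    SimpleGraph.binomialRandom V p = (Measure.infinitePi (edgeLaw p)).map graphOfEdges := by
  rw [SimpleGraph.binomialRandom_eq_map, setBernoulli_eq_map]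
  exact Measure.map_map SimpleGraph.measurable_fromEdgeSet MeasurableEquiv.setOfPred.measurable

/-- In the product model the presence of `e` depends on coordinate `e` alone; the conjunct `¬
e.IsDiag` reflects that `fromEdgeSet` discards loops. -/
lemma iIndepFun_edges :
    iIndepFun (fun (e : Sym2 V) (G : SimpleGraph V) => e ∈ G.edgeSet)
      (SimpleGraph.binomialRandom V p) := by
  have h := iIndepFun_infinitePi (P := edgeLaw p) (X := fun (e : Sym2 V) (x : Prop) =>
    x ∧ ¬ e.IsDiag) (fun e => by fun_prop)
  rw [iIndepFun_iff_measure_inter_preimage_eq_mul] at h ⊢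
  intro S sets hs
  have := h S hs
  rw [binomialRandom_eq_map_graphOfEdges, Measure.map_apply measurable_graphOfEdges
    (measurableSet_of_finite_graph _)]
  have hpre : ∀ e, graphOfEdges ⁻¹' ((fun G : SimpleGraph V => e ∈ G.edgeSet) ⁻¹' sets e)
      = (fun ω : Sym2 V → Prop => ω e ∧ ¬ e.IsDiag) ⁻¹' sets e := by
    intro e; ext ω; simp [graphOfEdges]
  simp only [Set.preimage_iInter, hpre]
  rw [this]
  refine Finset.prod_congr rfl fun e _ => ?_
  rw [Measure.map_apply measurable_graphOfEdges (measurableSet_of_finite_graph _), hpre]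

lemma binomialRandom_real_edge {e : Sym2 V} (he : ¬ e.IsDiag) :
    (SimpleGraph.binomialRandom V p).real {G | e ∈ G.edgeSet} = p := by
  have hpre : graphOfEdges ⁻¹' {G : SimpleGraph V | e ∈ G.edgeSet}
      = (fun ω : Sym2 V → Prop => ω e) ⁻¹' {x | x} := by
    ext ω; simp [graphOfEdges, he]
  rw [measureReal_def, binomialRandom_eq_map_graphOfEdges,
    Measure.map_apply measurable_graphOfEdges (measurableSet_of_finite_graph _), hpre,
    ← Measure.map_apply (measurable_pi_apply e) (by trivial)]
  erw [Measure.infinitePi_map_eval]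
  simp [edgeLaw, he, Set.indicator]

/-- The event `E` is determined by which of the pairs in `S` are edges. -/
def DeterminedBy (E : Set (SimpleGraph V)) (S : Finset (Sym2 V)) : Prop :=
  ∀ G G' : SimpleGraph V, (∀ e ∈ S, e ∈ G.edgeSet ↔ e ∈ G'.edgeSet) → (G ∈ E ↔ G' ∈ E)

lemma DeterminedBy.mono {E : Set (SimpleGraph V)} {S T : Finset (Sym2 V)} (h : DeterminedBy E S)
    (hST : S ⊆ T) : DeterminedBy E T :=
  fun G G' hG => h G G' fun e he => hG e (hST he)

lemma DeterminedBy.measure_inter {E F : Set (SimpleGraph V)} {S T : Finset (Sym2 V)}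
    (hE : DeterminedBy E S) (hF : DeterminedBy F T) (hST : Disjoint S T) :
    SimpleGraph.binomialRandom V p (E ∩ F) =
      SimpleGraph.binomialRandom V p E * SimpleGraph.binomialRandom V p F := by
  have h := (iIndepFun_edges (V := V) (p := p)).indepFun_finset S T hST
    (fun e => measurable_of_finite_graph _)
  rw [indepFun_iff_measure_inter_preimage_eq_mul] at h
  -- A determined event is the full preimage of its image under the edge indicators of `S`, so
  -- independence of the two indicator families applies to it.
  have key : ∀ {E : Set (SimpleGraph V)} {S : Finset (Sym2 V)}, DeterminedBy E S →
      (fun (G : SimpleGraph V) (e : S) => (e : Sym2 V) ∈ G.edgeSet) ⁻¹'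
        ((fun (G : SimpleGraph V) (e : S) => (e : Sym2 V) ∈ G.edgeSet) '' E) = E := by
    intro E S hE
    refine Set.Subset.antisymm ?_ (Set.subset_preimage_image _ _)
    rintro G ⟨G', hG', h⟩
    refine (hE G' G fun e he => ?_).1 hG'
    exact iff_of_eq (congrFun h ⟨e, he⟩)
  have := h _ _
    (Set.toFinite ((fun (G : SimpleGraph V) (e : S) => (e : Sym2 V) ∈ G.edgeSet) '' E)).measurableSet
    (Set.toFinite ((fun (G : SimpleGraph V) (e : T) => (e : Sym2 V) ∈ G.edgeSet) '' F)).measurableSet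
  rwa [key hE, key hF] at this

lemma DeterminedBy.biInter {ι : Type*} {s : Finset ι} {E : ι → Set (SimpleGraph V)}
    {S : ι → Finset (Sym2 V)} (hE : ∀ i ∈ s, DeterminedBy (E i) (S i)) :
    DeterminedBy (⋂ i ∈ s, E i) (s.biUnion S) := by
  intro G G' hG
  simp only [Set.mem_iInter]
  exact forall₂_congr fun i hi =>
    hE i hi G G' fun e he => hG e (Finset.mem_biUnion.2 ⟨i, hi, he⟩)

lemma measure_biInter_of_determinedBy {ι : Type*} {s : Finset ι} {E : ι → Set (SimpleGraph V)}
    {S : ι → Finset (Sym2 V)} (hE : ∀ i ∈ s, DeterminedBy (E i) (S i))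
    (hS : ∀ i ∈ s, ∀ j ∈ s, i ≠ j → Disjoint (S i) (S j)) :
    SimpleGraph.binomialRandom V p (⋂ i ∈ s, E i) =
      ∏ i ∈ s, SimpleGraph.binomialRandom V p (E i) := by
  induction s using Finset.induction_on with
  | empty => simp
  | insert i s hi ih =>
    have hE' : ∀ j ∈ s, DeterminedBy (E j) (S j) := fun j hj => hE j (Finset.mem_insert_of_mem hj)
    rw [Finset.set_biInter_insert, Finset.prod_insert hi, ← ih hE' fun j hj k hk =>
      hS j (Finset.mem_insert_of_mem hj) k (Finset.mem_insert_of_mem hk)]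
    refine (hE i (Finset.mem_insert_self i s)).measure_inter (DeterminedBy.biInter hE') ?_
    rw [Finset.disjoint_biUnion_right]
    exact fun j hj => hS i (Finset.mem_insert_self i s) j (Finset.mem_insert_of_mem hj)
      (fun h => hi (h ▸ hj))

lemma iIndepSet_of_determinedBy {ι : Type*} {E : ι → Set (SimpleGraph V)}
    {S : ι → Finset (Sym2 V)} (hE : ∀ i, DeterminedBy (E i) (S i))
    (hS : ∀ i j, i ≠ j → Disjoint (S i) (S j)) :
    iIndepSet E (SimpleGraph.binomialRandom V p) := by
  rw [iIndepSet_iff_meas_biInter fun i => measurableSet_of_finite_graph _]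
  exact fun s => measure_biInter_of_determinedBy (fun i _ => hE i) fun i _ j _ => hS i j

/-- If the value of `f` is determined by edges that do not determine the bad event for that value,
then the probability that `f` takes a relevant value and the bad event for it occurs is at most the
largest probability of a bad event. -/
lemma measure_exploration_le {α : Type*} [Fintype α] (f : SimpleGraph V → α)
    (R : Set α) (F : α → Set (SimpleGraph V)) (T T' : α → Finset (Sym2 V))
    (hf : ∀ a, DeterminedBy (f ⁻¹' {a}) (T a)) (hF : ∀ a, DeterminedBy (F a) (T' a))
    (hT : ∀ a, Disjoint (T a) (T' a)) {ε : ℝ} (hε : 0 ≤ ε)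
    (hFε : ∀ a ∈ R, (SimpleGraph.binomialRandom V p).real (F a) ≤ ε) :
    (SimpleGraph.binomialRandom V p).real {G | f G ∈ R ∧ G ∈ F (f G)} ≤ ε := by
  set P := SimpleGraph.binomialRandom V p
  -- On each level set of `f` the bad event is independent of the level, and the probabilities of
  -- the levels add up to one.
  have hdecomp : {G | f G ∈ R ∧ G ∈ F (f G)} ⊆
      ⋃ a ∈ Finset.univ.filter (· ∈ R), (f ⁻¹' {a} ∩ F a) := by
    rintro G ⟨h1, h2⟩
    simp only [Set.mem_iUnion, Finset.mem_filter]
    exact ⟨f G, ⟨Finset.mem_univ _, h1⟩, rfl, h2⟩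
  calc P.real {G | f G ∈ R ∧ G ∈ F (f G)}
      ≤ P.real (⋃ a ∈ Finset.univ.filter (· ∈ R), (f ⁻¹' {a} ∩ F a)) :=
        measureReal_mono hdecomp (measure_ne_top _ _)
    _ ≤ ∑ a ∈ Finset.univ.filter (· ∈ R), P.real (f ⁻¹' {a} ∩ F a) :=
        measureReal_biUnion_finset_le _ _
    _ ≤ ∑ a ∈ Finset.univ.filter (· ∈ R), P.real (f ⁻¹' {a}) * ε := by
        refine Finset.sum_le_sum fun a ha => ?_
        rw [measureReal_def, (hf a).measure_inter (hF a) (hT a), ENNReal.toReal_mul]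
        exact mul_le_mul_of_nonneg_left (hFε a (Finset.mem_filter.1 ha).2) measureReal_nonneg
    _ ≤ ∑ a, P.real (f ⁻¹' {a}) * ε :=
        Finset.sum_le_sum_of_subset_of_nonneg (Finset.filter_subset _ _)
          fun _ _ _ => mul_nonneg measureReal_nonneg hε
    _ = ε := by
        rw [← Finset.sum_mul, ← measureReal_biUnion_finset]
        · have : (⋃ b ∈ (Finset.univ : Finset α), f ⁻¹' {b}) = Set.univ := by ext; simp
          rw [this]; simp [P]
        · intro a _ b _ hab
          rw [Function.onFun, Set.disjoint_left]
          rintro G rfl h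
          exact hab h
        · exact fun _ _ => measurableSet_of_finite_graph _

end Independence

/-! ### Elementary inequalities for the exponential. -/

section Estimates

/-- Because `(1 + x + x²/2) (1 - x + x²/2) = 1 + x⁴/4 ≥ 1`. -/
lemma exp_neg_le_quadratic {x : ℝ} (hx : 0 ≤ x) : Real.exp (-x) ≤ 1 - x + x ^ 2 / 2 := by
  have := Real.quadratic_le_exp_of_nonneg hx
  rw [Real.exp_neg]
  have h3 : (Real.exp x)⁻¹ ≤ (1 + x + x ^ 2 / 2)⁻¹ := by gcongr
  refine h3.trans ?_
  rw [inv_le_iff_one_le_mul₀ (by positivity)]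
  nlinarith [sq_nonneg (x ^ 2)]

lemma exp_le_one_add_two_mul {x : ℝ} (hx : 0 ≤ x) (hx1 : x ≤ 1) : Real.exp x ≤ 1 + 2 * x := by
  have h := (abs_le.1 (Real.abs_exp_sub_one_sub_id_le (x := x) (by rwa [abs_of_nonneg hx]))).2
  nlinarith

lemma one_sub_pow_le_exp {p : ℝ} (hp : p ≤ 1) (a : ℕ) : (1 - p) ^ a ≤ Real.exp (-(p * a)) := by
  calc (1 - p) ^ a ≤ Real.exp (-p) ^ a :=
        pow_le_pow_left₀ (by linarith) (Real.one_sub_le_exp_neg p) a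
    _ = _ := by rw [← Real.exp_nat_mul]; congr 1; ring

/-- From `1 / (1 - p) = 1 + p / (1 - p) ≤ e^{p/(1-p)}`. -/
lemma exp_le_one_sub_pow {p : ℝ} (hp : p < 1) (a : ℕ) :
    Real.exp (-(p * a / (1 - p))) ≤ (1 - p) ^ a := by
  have h1 : 0 < 1 - p := by linarith
  have h : Real.exp (-(p / (1 - p))) ≤ 1 - p := by
    rw [Real.exp_neg]
    refine inv_le_of_inv_le₀ h1 ?_
    have := Real.add_one_le_exp (p / (1 - p))
    have h2 : (1 - p)⁻¹ = p / (1 - p) + 1 := by field_simp; ring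
    rw [h2]; exact this
  calc _ = Real.exp (-(p / (1 - p))) ^ a := by rw [← Real.exp_nat_mul]; congr 1; ring
    _ ≤ _ := pow_le_pow_left₀ (Real.exp_pos _).le h a

/-- Convexity of `exp` between `-c` and `0`. It turns a relative loss in the size of a sphere into
the same relative loss in the probability of being joined to it. -/
lemma mul_one_sub_exp_le {c t : ℝ} (ht0 : 0 ≤ t) (ht1 : t ≤ 1) :
    t * (1 - Real.exp (-c)) ≤ 1 - Real.exp (-(c * t)) := by
  have h := convexOn_exp.2 (Set.mem_univ (-c)) (Set.mem_univ 0) ht0 (sub_nonneg.2 ht1) (by ring)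
  simp only [smul_eq_mul, mul_zero, add_zero, Real.exp_zero, mul_one] at h
  have h2 : t * -c = -(c * t) := by ring
  rw [h2] at h
  linarith

end Estimates

/-! ### Chernoff bounds for independent events. -/

section Chernoff

open MeasureTheory ProbabilityTheory

variable {Ω ι : Type*} [MeasurableSpace Ω] [Fintype ι] {P : Measure Ω} [IsProbabilityMeasure P]
  {E : ι → Set Ω}

/-- The number of events of the family that occur. -/
def occurrences (E : ι → Set Ω) (ω : Ω) : ℝ := ∑ i, (E i).indicator (fun _ => (1 : ℝ)) ω

lemma mgf_indicator_one {A : Set Ω} (hA : MeasurableSet A) (t : ℝ) :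
    mgf (A.indicator fun _ => (1 : ℝ)) P t = 1 + P.real A * (Real.exp t - 1) := by
  have : (fun ω => Real.exp (t * A.indicator (fun _ => (1 : ℝ)) ω)) =
      fun ω => 1 + A.indicator (fun _ => Real.exp t - 1) ω := by
    ext ω
    by_cases h : ω ∈ A <;> simp [h]
  rw [mgf, this, integral_add (integrable_const _)
    ((integrable_const _).indicator hA), integral_indicator_const _ hA]
  simp

lemma mgf_occurrences (hE : iIndepSet E P) (hm : ∀ i, MeasurableSet (E i)) (t : ℝ) :
    mgf (occurrences E) P t = ∏ i, (1 + P.real (E i) * (Real.exp t - 1)) := by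
  have h := (hE.iIndepFun_indicator (β := ℝ)).mgf_sum (t := t)
    (fun i => measurable_const.indicator (hm i)) Finset.univ
  have h2 : occurrences E = ∑ i, (E i).indicator (fun _ => (1 : ℝ)) := by
    ext ω; simp [occurrences]
  rw [h2]
  refine h.trans (Finset.prod_congr rfl fun i _ => mgf_indicator_one (hm i) t)

lemma integrable_exp_occurrences (hm : ∀ i, MeasurableSet (E i)) (t : ℝ) :
    Integrable (fun ω => Real.exp (t * occurrences E ω)) P := by
  have hmeas : Measurable (occurrences E) := by
    unfold occurrences
    exact Finset.measurable_sum _ fun i _ => measurable_const.indicator (hm i)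
  refine integrable_exp_mul_of_mem_Icc (a := 0) (b := Fintype.card ι) hmeas.aemeasurable ?_
  refine ae_of_all _ fun ω => ⟨Finset.sum_nonneg fun i _ =>
    Set.indicator_nonneg (fun _ _ => zero_le_one) ω, ?_⟩
  calc occurrences E ω ≤ ∑ _i : ι, (1 : ℝ) :=
        Finset.sum_le_sum fun i _ => Set.indicator_le' (fun _ _ => le_rfl) (fun _ _ => zero_le_one) ω
    _ = _ := by simp

/-- The multiplicative Chernoff bound for the lower tail. -/
lemma measure_occurrences_le (hE : iIndepSet E P) (hm : ∀ i, MeasurableSet (E i)) {q δ μ : ℝ}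
    (hδ : 0 ≤ δ) (hq : ∀ i, q ≤ P.real (E i)) (hμ0 : 0 ≤ μ) (hμ : μ ≤ q * Fintype.card ι) :
    P.real {ω | occurrences E ω ≤ (1 - δ) * μ} ≤ Real.exp (-(δ ^ 2 * μ / 2)) := by
  -- The parameter `-δ` gives the exponent `μ (δ (1 - δ) + e^{-δ} - 1) ≤ -μ δ² / 2`.
  refine (measure_le_le_exp_mul_mgf _ (neg_nonpos.2 hδ)
    (integrable_exp_occurrences hm _)).trans ?_
  rw [mgf_occurrences hE hm]
  have he : Real.exp (-δ) - 1 ≤ -(δ - δ ^ 2 / 2) := by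
    linarith [exp_neg_le_quadratic hδ]
  have he0 : Real.exp (-δ) - 1 ≤ 0 := by
    have := Real.exp_le_one_iff.2 (neg_nonpos.2 hδ); linarith
  have hprod : ∏ i, (1 + P.real (E i) * (Real.exp (-δ) - 1)) ≤
      Real.exp (μ * (Real.exp (-δ) - 1)) := by
    calc _ ≤ ∏ _i : ι, Real.exp (q * (Real.exp (-δ) - 1)) := by
          refine Finset.prod_le_prod (fun i _ => ?_) fun i _ => ?_
          · have h1 : P.real (E i) ≤ 1 := measureReal_le_one
            have h0 : 0 ≤ P.real (E i) := measureReal_nonneg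
            have := Real.exp_pos (-δ)
            nlinarith
          · have := Real.add_one_le_exp (q * (Real.exp (-δ) - 1))
            have := mul_le_mul_of_nonpos_right (hq i) he0
            linarith
      _ = Real.exp (q * Fintype.card ι * (Real.exp (-δ) - 1)) := by
          rw [Finset.prod_const, ← Real.exp_nat_mul]
          congr 1
          simp only [Finset.card_univ]; ring
      _ ≤ _ := Real.exp_le_exp.2 (mul_le_mul_of_nonpos_right hμ he0)
  calc _ ≤ Real.exp (- -δ * ((1 - δ) * μ)) * Real.exp (μ * (Real.exp (-δ) - 1)) := by gcongr
    _ = Real.exp (μ * (δ * (1 - δ) + (Real.exp (-δ) - 1))) := by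
        rw [← Real.exp_add]; congr 1; ring
    _ ≤ _ := by
        refine Real.exp_le_exp.2 ?_
        nlinarith

/-- The multiplicative Chernoff bound for the upper tail. -/
lemma measure_le_occurrences (hE : iIndepSet E P) (hm : ∀ i, MeasurableSet (E i)) {q δ μ : ℝ}
    (hδ : 0 ≤ δ) (hδ1 : δ ≤ 1) (hq : ∀ i, P.real (E i) ≤ q) (hμ0 : 0 ≤ μ)
    (hμ : q * Fintype.card ι ≤ μ) :
    P.real {ω | (1 + δ) * μ ≤ occurrences E ω} ≤ Real.exp (-(δ ^ 2 * μ / 4)) := by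
  -- With `t = δ / 2` the bound `e^t - 1 ≤ t + t²` already makes the exponent at most `-μ δ² / 4`;
  -- the optimal `t` is not needed.
  refine (measure_ge_le_exp_mul_mgf (t := δ / 2) _ (by positivity)
    (integrable_exp_occurrences hm _)).trans ?_
  rw [mgf_occurrences hE hm]
  have he : Real.exp (δ / 2) - 1 ≤ δ / 2 + (δ / 2) ^ 2 := by
    have h := Real.abs_exp_sub_one_sub_id_le (x := δ / 2) (by rw [abs_of_nonneg] <;> linarith)
    have := (abs_le.1 h).2
    linarith
  have he0 : 0 ≤ Real.exp (δ / 2) - 1 := by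
    have := Real.one_le_exp (x := δ / 2) (by positivity); linarith
  have hprod : ∏ i, (1 + P.real (E i) * (Real.exp (δ / 2) - 1)) ≤
      Real.exp (μ * (Real.exp (δ / 2) - 1)) := by
    calc _ ≤ ∏ _i : ι, Real.exp (q * (Real.exp (δ / 2) - 1)) := by
          refine Finset.prod_le_prod (fun i _ => ?_) fun i _ => ?_
          · have h0 : 0 ≤ P.real (E i) := measureReal_nonneg
            positivity
          · have := Real.add_one_le_exp (q * (Real.exp (δ / 2) - 1))
            have := mul_le_mul_of_nonneg_right (hq i) he0
            linarith
      _ = Real.exp (q * Fintype.card ι * (Real.exp (δ / 2) - 1)) := by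
          rw [Finset.prod_const, ← Real.exp_nat_mul]
          congr 1
          simp only [Finset.card_univ]; ring
      _ ≤ _ := Real.exp_le_exp.2 (mul_le_mul_of_nonneg_right hμ he0)
  calc _ ≤ Real.exp (-(δ / 2) * ((1 + δ) * μ)) * Real.exp (μ * (Real.exp (δ / 2) - 1)) := by gcongr
    _ = Real.exp (μ * (-(δ / 2) * (1 + δ) + (Real.exp (δ / 2) - 1))) := by
        rw [← Real.exp_add]; congr 1; ring
    _ ≤ _ := by
        refine Real.exp_le_exp.2 ?_
        nlinarith

end Chernoff

/-! ### Balls as iterated closed neighbourhoods, and their growth. -/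

section Balls

variable {V : Type*} [Fintype V] [DecidableEq V]

lemma expand_mono (G : SimpleGraph V) {A B : Finset V} (h : A ⊆ B) : expand G A ⊆ expand G B := by
  intro w hw
  rw [mem_expand] at hw ⊢
  rcases hw with hw | ⟨a, ha, hw⟩
  · exact Or.inl (h hw)
  · exact Or.inr ⟨a, h ha, hw⟩

lemma iterate_expand_mono (G : SimpleGraph V) {A B : Finset V} (h : A ⊆ B) (j : ℕ) :
    (expand G)^[j] A ⊆ (expand G)^[j] B :=
  Monotone.iterate (f := expand G) (fun _ _ => expand_mono G) j h

lemma iterate_expand_subset (G : SimpleGraph V) (A : Finset V) {i j : ℕ} (h : i ≤ j) :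
    (expand G)^[i] A ⊆ (expand G)^[j] A := by
  induction j, h using Nat.le_induction with
  | base => rfl
  | succ j _ ih =>
    rw [Function.iterate_succ_apply']
    exact ih.trans (subset_expand G _)

lemma expand_union (G : SimpleGraph V) (A B : Finset V) :
    expand G (A ∪ B) = expand G A ∪ expand G B := by
  ext w
  simp only [mem_expand, Finset.mem_union]
  constructor
  · rintro ((h | h) | ⟨a, h | h, hw⟩)
    exacts [Or.inl (Or.inl h), Or.inr (Or.inl h), Or.inl (Or.inr ⟨a, h, hw⟩),
      Or.inr (Or.inr ⟨a, h, hw⟩)]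
  · rintro ((h | ⟨a, h, hw⟩) | (h | ⟨a, h, hw⟩))
    exacts [Or.inl (Or.inl h), Or.inr ⟨a, Or.inl h, hw⟩, Or.inl (Or.inr h),
      Or.inr ⟨a, Or.inr h, hw⟩]

lemma iterate_expand_union (G : SimpleGraph V) (A B : Finset V) (j : ℕ) :
    (expand G)^[j] (A ∪ B) = (expand G)^[j] A ∪ (expand G)^[j] B := by
  induction j with
  | zero => rfl
  | succ j ih => rw [Function.iterate_succ_apply', ih, expand_union,
      Function.iterate_succ_apply', Function.iterate_succ_apply']

lemma mem_iterate_expand_of_walk {G : SimpleGraph V} {u w : V} (c : G.Walk u w) :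
    w ∈ (expand G)^[c.length] {u} := by
  induction c with
  | nil => simp
  | cons h c ih =>
    rw [SimpleGraph.Walk.length_cons, Function.iterate_succ_apply]
    refine iterate_expand_mono G ?_ _ ih
    rw [Finset.singleton_subset_iff, mem_expand]
    exact Or.inr ⟨_, by simp, h⟩

lemma mem_iterate_expand_iff {G : SimpleGraph V} {u w : V} {j : ℕ} :
    w ∈ (expand G)^[j] {u} ↔ G.edist u w ≤ j := by
  constructor
  · intro h
    induction j generalizing w with
    | zero => simp_all
    | succ j ih =>
      rw [Function.iterate_succ_apply', mem_expand] at h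
      rcases h with h | ⟨a, ha, h⟩
      · exact (ih h).trans (by exact_mod_cast Nat.le_succ j)
      · calc G.edist u w ≤ G.edist u a + G.edist a w := G.edist_triangle
          _ ≤ j + 1 := add_le_add (ih ha) (SimpleGraph.edist_eq_one_iff_adj.2 h).le
          _ = _ := by push_cast; rfl
  · intro h
    obtain ⟨c, hc⟩ := SimpleGraph.exists_walk_of_edist_ne_top
      (ne_top_of_le_ne_top (ENat.natCast_ne_top j) h)
    rw [← hc] at h
    exact iterate_expand_subset G _ (by exact_mod_cast h) (mem_iterate_expand_of_walk c)

lemma card_expand_le_of_singleton {G : SimpleGraph V} {D : ℕ}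
    (hD : ∀ v, (expand G {v}).card ≤ D) (A : Finset V) : (expand G A).card ≤ D * A.card := by
  have : expand G A ⊆ A.biUnion fun a => expand G {a} := by
    intro w hw
    rw [mem_expand] at hw
    rw [Finset.mem_biUnion]
    rcases hw with hw | ⟨a, ha, hw⟩
    · exact ⟨w, hw, by simp [mem_expand]⟩
    · exact ⟨a, ha, by simp [mem_expand, hw]⟩
  rw [mul_comm]
  exact (Finset.card_le_card this).trans (Finset.card_biUnion_le_card_mul _ _ _ fun a _ => hD a)

/-- The vertices at distance exactly `j + 1` from `v` and more than `j + 1` from `u`. -/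
def freshSphere (G : SimpleGraph V) (u v : V) (j : ℕ) : Finset V :=
  (expand G)^[j + 1] {v} \ ((expand G)^[j + 1] {u} ∪ (expand G)^[j] {v})

/-- The vertices at distance at most `j` from `v` and more than `j` from `u`. -/
def ballDiff (G : SimpleGraph V) (u v : V) (j : ℕ) : Finset V :=
  (expand G)^[j] {v} \ (expand G)^[j] {u}

/-- The four sets are pairwise disjoint, and in each of them one of `u`, `v` is within a radius (`j`
or `j + 1`) that excludes the other. Both orders of `u` and `v` count, which is the source of the
factor 2 in the rate. -/
lemma card_distinguishing_ge (G : SimpleGraph V) (u v : V) (j : ℕ) :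
    (freshSphere G u v j).card + (freshSphere G v u j).card +
      ((ballDiff G u v j).card + (ballDiff G v u j).card) ≤ (distinguishing G u v).card := by
  have hsub : ∀ w x, w ∈ (expand G)^[j] {x} → w ∈ (expand G)^[j + 1] {x} :=
    fun w x h => iterate_expand_subset G _ (Nat.le_succ j) h
  have hmem : ∀ s k, s ∈ (expand G)^[k] {v} → s ∉ (expand G)^[k] {u} →
      s ∈ distinguishing G u v := by
    intro s k h1 h2
    rw [mem_iterate_expand_iff] at h1 h2
    simp only [distinguishing, Finset.mem_filter, Finset.mem_univ, true_and]
    intro h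
    rw [SimpleGraph.edist_comm, ← h, SimpleGraph.edist_comm] at h1
    exact h2 h1
  have hmem' : ∀ s k, s ∈ (expand G)^[k] {u} → s ∉ (expand G)^[k] {v} →
      s ∈ distinguishing G u v := by
    intro s k h1 h2
    rw [mem_iterate_expand_iff] at h1 h2
    simp only [distinguishing, Finset.mem_filter, Finset.mem_univ, true_and]
    intro h
    rw [SimpleGraph.edist_comm, h, SimpleGraph.edist_comm] at h1
    exact h2 h1
  rw [← Finset.card_union_of_disjoint, ← Finset.card_union_of_disjoint,
    ← Finset.card_union_of_disjoint]
  · refine Finset.card_le_card fun s hs => ?_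
    simp only [freshSphere, ballDiff, Finset.mem_union, Finset.mem_sdiff, not_or] at hs
    rcases hs with ((h | h) | (h | h))
    exacts [hmem s _ h.1 h.2.1, hmem' s _ h.1 h.2.1, hmem s _ h.1 h.2, hmem' s _ h.1 h.2]
  all_goals
    rw [Finset.disjoint_left]
    intro s hs hs'
    simp only [freshSphere, ballDiff, Finset.mem_union, Finset.mem_sdiff, not_or] at hs hs'
    have h1 := hsub s u
    have h2 := hsub s v
    tauto

/-- The ball around `{u, v}` is the union of the two balls. Expansion of the pair thus bounds their
overlap without any separate analysis of intersections. -/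
lemma card_ballDiff_ge (G : SimpleGraph V) (u v : V) (j : ℕ) :
    ((expand G)^[j] {u, v}).card ≤ ((expand G)^[j] {u}).card + (ballDiff G u v j).card := by
  have : (expand G)^[j] {u, v} = (expand G)^[j] {u} ∪ ballDiff G u v j := by
    rw [ballDiff, Finset.union_sdiff_self_eq_union, ← iterate_expand_union]
    rfl
  rw [this]
  exact Finset.card_union_le _ _

lemma card_iterate_expand_le {G : SimpleGraph V} {D : ℝ} (hD0 : 0 ≤ D)
    (hD : ∀ A : Finset V, ((expand G A).card : ℝ) ≤ D * A.card) (A : Finset V) (j : ℕ) :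
    (((expand G)^[j] A).card : ℝ) ≤ D ^ j * A.card := by
  induction j with
  | zero => simp
  | succ j ih =>
    rw [Function.iterate_succ_apply']
    calc _ ≤ D * (((expand G)^[j] A).card : ℝ) := hD _
      _ ≤ D * (D ^ j * A.card) := by gcongr
      _ = _ := by ring

/-- Lower expansion is available only up to size `M`; the upper bound keeps the iterates up to `m`
below `M`, which permits `m + 1` steps. -/
lemma card_iterate_expand_ge {G : SimpleGraph V} {D K M : ℝ} (hD : 1 ≤ D) (hK : 0 ≤ K)
    (hup : ∀ A : Finset V, ((expand G A).card : ℝ) ≤ D * A.card)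
    (hlow : ∀ A : Finset V, A.Nonempty → (A.card : ℝ) ≤ M → K * A.card ≤ ((expand G A).card : ℝ))
    {A : Finset V} (hA : A.Nonempty) {m : ℕ} (hM : D ^ m * A.card ≤ M) {j : ℕ} (hj : j ≤ m + 1) :
    K ^ j * A.card ≤ (((expand G)^[j] A).card : ℝ) := by
  induction j with
  | zero => simp
  | succ j ih =>
    rw [Function.iterate_succ_apply']
    have hne : ((expand G)^[j] A).Nonempty :=
      hA.mono (iterate_expand_subset G A (Nat.zero_le j))
    have hcard : (((expand G)^[j] A).card : ℝ) ≤ M := by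
      refine (card_iterate_expand_le (by linarith) hup A j).trans (le_trans ?_ hM)
      gcongr
      omega
    calc K ^ (j + 1) * A.card = K * (K ^ j * A.card) := by ring
      _ ≤ K * (((expand G)^[j] A).card : ℝ) := by gcongr; exact ih (by omega)
      _ ≤ _ := hlow _ hne hcard

end Balls

/-! ### Neighbourhoods of fixed sets: probabilities and concentration. -/

section Links

open MeasureTheory ProbabilityTheory

variable {V : Type*} [Fintype V] [DecidableEq V] {p : unitInterval}

/-- The event that `w` has no neighbour in `X` and some neighbour in `Y`. -/
def linkEvent (X Y : Finset V) (w : V) : Set (SimpleGraph V) :=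
  {G | (∀ x ∈ X, ¬ G.Adj x w) ∧ ∃ y ∈ Y, G.Adj y w}

/-- The vertices of `W` without neighbours in `X` and with some neighbour in `Y`. -/
def linked (G : SimpleGraph V) (X Y W : Finset V) : Finset V :=
  W.filter fun w => G ∈ linkEvent X Y w

/-- The pairs that join `w` to `X`. -/
def star (X : Finset V) (w : V) : Finset (Sym2 V) := X.image fun x => s(x, w)

lemma determinedBy_no_neighbour (X : Finset V) (w : V) :
    DeterminedBy {G : SimpleGraph V | ∀ x ∈ X, ¬ G.Adj x w} (star X w) := by
  intro G G' h
  refine forall₂_congr fun x hx => not_congr ?_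
  exact h s(x, w) (Finset.mem_image_of_mem _ hx)

lemma determinedBy_neighbour (Y : Finset V) (w : V) :
    DeterminedBy {G : SimpleGraph V | ∃ y ∈ Y, G.Adj y w} (star Y w) := by
  intro G G' h
  refine exists_congr fun y => and_congr_right fun hy => ?_
  exact h s(y, w) (Finset.mem_image_of_mem _ hy)

lemma determinedBy_linkEvent (X Y : Finset V) (w : V) :
    DeterminedBy (linkEvent X Y w) (star (X ∪ Y) w) := by
  intro G G' h
  exact and_congr
    ((determinedBy_no_neighbour X w).mono (Finset.image_subset_image Finset.subset_union_left) G G' h)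
    ((determinedBy_neighbour Y w).mono (Finset.image_subset_image Finset.subset_union_right) G G' h)

lemma disjoint_star_of_disjoint {X Y : Finset V} (h : Disjoint X Y) (w : V) :
    Disjoint (star X w) (star Y w) := by
  simp only [star, Finset.disjoint_left, Finset.mem_image]
  rintro _ ⟨x, hx, rfl⟩ ⟨y, hy, hxy⟩
  have : y = x := by
    rcases Sym2.eq_iff.1 hxy with h | h
    · exact h.1
    · rw [h.1, ← h.2]
  exact Finset.disjoint_left.1 h hx (this ▸ hy)

lemma disjoint_star_of_ne {X : Finset V} {w w' : V} (hne : w ≠ w') (hw : w ∉ X) :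
    Disjoint (star X w) (star X w') := by
  simp only [star, Finset.disjoint_left, Finset.mem_image]
  rintro _ ⟨x, hx, rfl⟩ ⟨y, hy, hxy⟩
  rcases Sym2.eq_iff.1 hxy with h | h
  · exact hne h.2.symm
  · exact hw (h.1 ▸ hy)

lemma binomialRandom_real_no_neighbour {X : Finset V} {w : V} (hw : w ∉ X) :
    (SimpleGraph.binomialRandom V p).real {G | ∀ x ∈ X, ¬ G.Adj x w} =
      (1 - (p : ℝ)) ^ X.card := by
  have hset : {G : SimpleGraph V | ∀ x ∈ X, ¬ G.Adj x w} = ⋂ x ∈ X, {G | s(x, w) ∈ G.edgeSet}ᶜ := by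
    ext G; simp
  rw [hset, measureReal_def, measure_biInter_of_determinedBy (S := fun x => {s(x, w)}),
    ENNReal.toReal_prod, ← Finset.prod_const]
  · refine Finset.prod_congr rfl fun x hx => ?_
    rw [← measureReal_def, probReal_compl_eq_one_sub (measurableSet_of_finite_graph _),
      binomialRandom_real_edge]
    simp only [Sym2.mk_isDiag_iff]
    rintro rfl
    exact hw hx
  · intro x _ G G' h
    exact not_congr (h _ (by simp))
  · intro x _ y _ hxy
    simp only [Finset.disjoint_singleton]
    intro h
    rcases Sym2.eq_iff.1 h with h | h
    · exact hxy h.1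
    · exact hxy (h.1.trans h.2)

lemma binomialRandom_real_linkEvent {X Y : Finset V} (hXY : Disjoint X Y) {w : V}
    (hX : w ∉ X) (hY : w ∉ Y) :
    (SimpleGraph.binomialRandom V p).real (linkEvent X Y w) =
      (1 - (p : ℝ)) ^ X.card * (1 - (1 - (p : ℝ)) ^ Y.card) := by
  have h := (determinedBy_no_neighbour X w).measure_inter (p := p) (determinedBy_neighbour Y w)
    (disjoint_star_of_disjoint hXY w)
  have h2 : {G : SimpleGraph V | ∃ y ∈ Y, G.Adj y w} = {G | ∀ y ∈ Y, ¬ G.Adj y w}ᶜ := by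
    ext G; simp
  have h3 : linkEvent X Y w = {G | ∀ x ∈ X, ¬ G.Adj x w} ∩ {G | ∃ y ∈ Y, G.Adj y w} := rfl
  rw [h3, measureReal_def, h, ENNReal.toReal_mul, ← measureReal_def, ← measureReal_def, h2,
    probReal_compl_eq_one_sub (measurableSet_of_finite_graph _),
    binomialRandom_real_no_neighbour hX, binomialRandom_real_no_neighbour hY]

/-- Since `W` avoids `X ∪ Y`, no pair joins two different vertices of `W` to `X ∪ Y` at once. -/
lemma iIndepSet_linkEvent {X Y W : Finset V} (hX : Disjoint W X) (hY : Disjoint W Y) :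
    iIndepSet (fun w : W => linkEvent X Y (w : V)) (SimpleGraph.binomialRandom V p) := by
  refine iIndepSet_of_determinedBy (S := fun w : W => star (X ∪ Y) (w : V))
    (fun w => determinedBy_linkEvent X Y _) fun w w' hne => ?_
  refine disjoint_star_of_ne (fun h => hne (Subtype.ext h)) ?_
  rw [Finset.mem_union, not_or]
  exact ⟨Finset.disjoint_left.1 hX w.2, Finset.disjoint_left.1 hY w.2⟩

lemma occurrences_linkEvent (X Y W : Finset V) (G : SimpleGraph V) :
    occurrences (fun w : W => linkEvent X Y (w : V)) G = (linked G X Y W).card := by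
  rw [occurrences, Finset.sum_coe_sort W fun w => (linkEvent X Y w).indicator (fun _ => (1 : ℝ)) G,
    linked, Finset.card_filter]
  push_cast
  exact Finset.sum_congr rfl fun w _ => by simp [Set.indicator]

lemma measure_card_linked_le {X Y W : Finset V} (hXY : Disjoint X Y) (hX : Disjoint W X)
    (hY : Disjoint W Y) {δ μ : ℝ} (hδ : 0 ≤ δ) (hμ0 : 0 ≤ μ)
    (hμ : μ ≤ (1 - (p : ℝ)) ^ X.card * (1 - (1 - (p : ℝ)) ^ Y.card) * W.card) :
    (SimpleGraph.binomialRandom V p).real {G | ((linked G X Y W).card : ℝ) ≤ (1 - δ) * μ} ≤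
      Real.exp (-(δ ^ 2 * μ / 2)) := by
  have h := measure_occurrences_le (iIndepSet_linkEvent (p := p) hX hY)
    (fun w => measurableSet_of_finite_graph _) (q := (1 - (p : ℝ)) ^ X.card *
      (1 - (1 - (p : ℝ)) ^ Y.card)) hδ (fun w => (binomialRandom_real_linkEvent hXY
        (Finset.disjoint_left.1 hX w.2) (Finset.disjoint_left.1 hY w.2)).ge) hμ0
      (by simpa using hμ)
  simpa only [occurrences_linkEvent] using h

lemma measure_le_card_linked {X Y W : Finset V} (hXY : Disjoint X Y) (hX : Disjoint W X)
    (hY : Disjoint W Y) {δ μ : ℝ} (hδ : 0 ≤ δ) (hδ1 : δ ≤ 1) (hμ0 : 0 ≤ μ)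
    (hμ : (1 - (p : ℝ)) ^ X.card * (1 - (1 - (p : ℝ)) ^ Y.card) * W.card ≤ μ) :
    (SimpleGraph.binomialRandom V p).real {G | (1 + δ) * μ ≤ ((linked G X Y W).card : ℝ)} ≤
      Real.exp (-(δ ^ 2 * μ / 4)) := by
  have h := measure_le_occurrences (iIndepSet_linkEvent (p := p) hX hY)
    (fun w => measurableSet_of_finite_graph _) (q := (1 - (p : ℝ)) ^ X.card *
      (1 - (1 - (p : ℝ)) ^ Y.card)) hδ hδ1 (fun w => (binomialRandom_real_linkEvent hXY
        (Finset.disjoint_left.1 hX w.2) (Finset.disjoint_left.1 hY w.2)).le) hμ0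
      (by simpa using hμ)
  simpa only [occurrences_linkEvent] using h

/-- All closed neighbourhoods are small with high probability. -/
lemma measure_exists_large_expand_le {δ : ℝ} (hδ : 0 ≤ δ) (hδ1 : δ ≤ 1) :
    (SimpleGraph.binomialRandom V p).real
      {G | ∃ v, (1 + δ) * (p * Fintype.card V) + 1 ≤ ((expand G {v}).card : ℝ)} ≤
      Fintype.card V * Real.exp (-(δ ^ 2 * (p * Fintype.card V) / 4)) := by
  set d : ℝ := p * Fintype.card V with hd
  have hp0 : (0 : ℝ) ≤ p := p.2.1
  have hd0 : 0 ≤ d := by positivity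
  have hsub : {G : SimpleGraph V | ∃ v, (1 + δ) * d + 1 ≤ ((expand G {v}).card : ℝ)} ⊆
      ⋃ v ∈ (Finset.univ : Finset V),
        {G | (1 + δ) * d ≤ ((linked G ∅ {v} {v}ᶜ).card : ℝ)} := by
    rintro G ⟨v, hv⟩
    simp only [Set.mem_iUnion]
    refine ⟨v, Finset.mem_univ v, ?_⟩
    have hcard : (expand G {v}).card ≤ (linked G ∅ {v} {v}ᶜ).card + 1 := by
      refine (Finset.card_le_card ?_).trans (Finset.card_insert_le v _)
      intro w hw
      rw [mem_expand] at hw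
      by_cases hwv : w = v
      · simp [hwv]
      · have : G.Adj v w := by simpa [hwv] using hw
        simp [linked, linkEvent, hwv, this]
    have : ((expand G {v}).card : ℝ) ≤ (linked G ∅ {v} {v}ᶜ).card + 1 := by exact_mod_cast hcard
    show (1 + δ) * d ≤ _
    linarith
  calc _ ≤ _ := measureReal_mono hsub (measure_ne_top _ _)
    _ ≤ _ := measureReal_biUnion_finset_le _ _
    _ ≤ ∑ _v : V, Real.exp (-(δ ^ 2 * d / 4)) := by
        refine Finset.sum_le_sum fun v _ => measure_le_card_linked (by simp) (by simp)
          (by simp) hδ hδ1 hd0 ?_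
        simp only [Finset.card_empty, pow_zero, Finset.card_singleton, pow_one, one_mul]
        have : (({v}ᶜ : Finset V).card : ℝ) ≤ Fintype.card V := by
          exact_mod_cast Finset.card_le_univ _
        rw [hd]
        nlinarith
    _ = _ := by simp

/-- All small sets expand with high probability. -/
lemma measure_exists_small_expand_le {δ κ r M : ℝ} (hδ : 0 ≤ δ) (hκ : 0 ≤ κ)
    (hμ : ∀ a : ℕ, 1 ≤ a → (a : ℝ) ≤ M →
      κ * a ≤ (1 - (1 - (p : ℝ)) ^ a) * (Fintype.card V - a))
    (hr : Real.exp (-(δ ^ 2 * κ / 2)) ≤ r) :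
    (SimpleGraph.binomialRandom V p).real
      {G | ∃ A : Finset V, A.Nonempty ∧ (A.card : ℝ) ≤ M ∧
        ((expand G A).card : ℝ) ≤ (1 - δ) * (κ * A.card)} ≤
      (1 + r) ^ Fintype.card V - 1 := by
  set good : Finset (Finset V) := Finset.univ.filter fun A => A.Nonempty ∧ (A.card : ℝ) ≤ M
  have hr0 : 0 ≤ r := (Real.exp_pos _).le.trans hr
  have hsub : {G : SimpleGraph V | ∃ A : Finset V, A.Nonempty ∧ (A.card : ℝ) ≤ M ∧
        ((expand G A).card : ℝ) ≤ (1 - δ) * (κ * A.card)} ⊆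
      ⋃ A ∈ good, {G | ((linked G ∅ A Aᶜ).card : ℝ) ≤ (1 - δ) * (κ * A.card)} := by
    rintro G ⟨A, hA, hAM, hG⟩
    simp only [Set.mem_iUnion]
    refine ⟨A, by simp [good, hA, hAM], le_trans ?_ hG⟩
    refine Nat.cast_le.2 (Finset.card_le_card fun w hw => ?_)
    obtain ⟨-, -, h⟩ := Finset.mem_filter.1 hw
    exact mem_expand.2 (Or.inr h)
  calc _ ≤ _ := measureReal_mono hsub (measure_ne_top _ _)
    _ ≤ _ := measureReal_biUnion_finset_le _ _
    -- The Chernoff exponent is proportional to `|A|`, so a set fails with probability at most `r ^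
    -- |A|`. Summing over all nonempty sets gives `(1 + r)^n - 1` by the binomial theorem.
    _ ≤ ∑ A ∈ good, r ^ A.card := by
        refine Finset.sum_le_sum fun A hA => ?_
        simp only [good, Finset.mem_filter] at hA
        refine (measure_card_linked_le (by simp) (by simp) disjoint_compl_left
          hδ (by positivity) ?_).trans ?_
        · have := hμ A.card hA.2.1.card_pos hA.2.2
          rw [Finset.card_compl, Nat.cast_sub (Finset.card_le_univ A)]
          simpa using this
        · calc _ = Real.exp (-(δ ^ 2 * κ / 2)) ^ A.card := by
                rw [← Real.exp_nat_mul]; congr 1; ring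
            _ ≤ _ := by gcongr
    _ ≤ ∑ A ∈ (Finset.univ : Finset (Finset V)).erase ∅, r ^ A.card := by
        refine Finset.sum_le_sum_of_subset_of_nonneg (fun A hA => ?_)
          fun _ _ _ => pow_nonneg hr0 _
        simp only [good, Finset.mem_filter] at hA
        simp [hA.2.1.ne_empty]
    _ = (1 + r) ^ Fintype.card V - 1 := by
        rw [Finset.sum_erase_eq_sub (Finset.mem_univ _)]
        have := Finset.sum_pow_mul_eq_add_pow r 1 (Finset.univ : Finset V)
        simp only [one_pow, mul_one, Finset.powerset_univ, Finset.card_univ] at this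
        rw [this, add_comm]
        simp

end Links

/-! ### Revealing balls and the randomness that remains. -/

section Exploration

open MeasureTheory ProbabilityTheory

variable {V : Type*} [Fintype V] [DecidableEq V] {p : unitInterval}

/-- The pairs that meet `Z`. -/
def touching (Z : Finset V) : Finset (Sym2 V) := Finset.univ.filter fun e => ∃ z ∈ Z, z ∈ e

lemma expand_eq_of_agree {G G' : SimpleGraph V} {Z A : Finset V}
    (h : ∀ e ∈ touching Z, e ∈ G.edgeSet ↔ e ∈ G'.edgeSet) (hA : A ⊆ Z) :
    expand G A = expand G' A := by
  ext w
  rw [mem_expand, mem_expand]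
  refine or_congr_right (exists_congr fun a => and_congr_right fun ha => ?_)
  exact h s(a, w) (by
    simp only [touching, Finset.mem_filter, Finset.mem_univ, true_and]
    exact ⟨a, hA ha, by simp⟩)

lemma iterate_expand_eq_of_agree {G G' : SimpleGraph V} {Z A : Finset V} {m : ℕ}
    (h : ∀ e ∈ touching Z, e ∈ G.edgeSet ↔ e ∈ G'.edgeSet) (hA : (expand G)^[m] A ⊆ Z) {j : ℕ}
    (hj : j ≤ m + 1) : (expand G)^[j] A = (expand G')^[j] A := by
  induction j with
  | zero => rfl
  | succ j ih =>
    rw [Function.iterate_succ_apply', Function.iterate_succ_apply', ← ih (by omega)]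
    exact expand_eq_of_agree h ((iterate_expand_subset G A (by omega)).trans hA)

/-- The balls of radius `m` and `m + 1` around `u` and `v`. -/
def exploration (u v : V) (m : ℕ) (G : SimpleGraph V) :
    (Finset V × Finset V) × Finset V × Finset V :=
  (((expand G)^[m] {u}, (expand G)^[m] {v}), (expand G)^[m + 1] {u}, (expand G)^[m + 1] {v})

/-- Breadth-first search finds the balls of radius `m + 1` by querying only pairs that meet the
balls of radius `m`. Pairs between the outer layers and the outside stay unexposed. -/
lemma determinedBy_exploration (u v : V) (m : ℕ)
    (a : (Finset V × Finset V) × Finset V × Finset V) :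
    DeterminedBy (exploration u v m ⁻¹' {a}) (touching (a.1.1 ∪ a.1.2)) := by
  have key : ∀ G G' : SimpleGraph V,
      (∀ e ∈ touching (a.1.1 ∪ a.1.2), e ∈ G.edgeSet ↔ e ∈ G'.edgeSet) →
      exploration u v m G = a → exploration u v m G' = a := by
    intro G G' h hG
    have hu : (expand G)^[m] {u} ⊆ a.1.1 ∪ a.1.2 := by
      rw [← hG]; exact Finset.subset_union_left
    have hv : (expand G)^[m] {v} ⊆ a.1.1 ∪ a.1.2 := by
      rw [← hG]; exact Finset.subset_union_right
    rw [← hG]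
    simp only [exploration]
    rw [iterate_expand_eq_of_agree h hu (Nat.le_succ m), iterate_expand_eq_of_agree h hu le_rfl,
      iterate_expand_eq_of_agree h hv (Nat.le_succ m), iterate_expand_eq_of_agree h hv le_rfl]
  exact fun G G' h => ⟨key G G' h, key G' G fun e he => (h e he).symm⟩

/-- A vertex outside both balls of radius `m + 1` has no neighbour in the balls of radius `m`.
Removing these from the first set therefore loses nothing, and only unexposed pairs are left to
examine. -/
lemma linked_subset_freshSphere (G : SimpleGraph V) (u v : V) (m : ℕ) (W : Finset V)
    (hW : W = ((expand G)^[m + 1] {u} ∪ (expand G)^[m + 1] {v})ᶜ) :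
    linked G ((expand G)^[m + 1] {u} \ ((expand G)^[m] {u} ∪ (expand G)^[m] {v}))
      (ballDiff G u v (m + 1) \ ((expand G)^[m] {u} ∪ (expand G)^[m] {v})) W ⊆
      freshSphere G u v (m + 1) := by
  intro w hw
  subst hW
  simp only [linked, linkEvent, ballDiff, Finset.mem_filter, Finset.mem_compl, Finset.mem_union,
    not_or, Set.mem_ofPred_eq, Finset.mem_sdiff] at hw
  obtain ⟨⟨hwu, hwv⟩, hno, y, ⟨⟨hyv, -⟩, -⟩, hy⟩ := hw
  simp only [freshSphere, Finset.mem_sdiff, Finset.mem_union, not_or]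
  refine ⟨?_, ?_, hwv⟩
  · rw [Function.iterate_succ_apply', mem_expand]
    exact Or.inr ⟨y, hyv, hy⟩
  · rw [Function.iterate_succ_apply', mem_expand]
    rintro (h | ⟨x, hx, h⟩)
    · exact hwu h
    · refine hno x ⟨hx, fun hxu => hwu ?_, fun hxv => hwv ?_⟩ h
      · rw [Function.iterate_succ_apply', mem_expand]
        exact Or.inr ⟨x, hxu, h⟩
      · rw [Function.iterate_succ_apply', mem_expand]
        exact Or.inr ⟨x, hxv, h⟩

/-- Given the balls of radius `m + 1`, the next sphere around `v` contains many vertices that are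
far from `u`, with high probability. -/
lemma measure_card_freshSphere_le (u v : V) (m : ℕ) {δ μ hi lo N : ℝ} (hδ : 0 ≤ δ) (hμ0 : 0 ≤ μ)
    (hμ : ∀ x y z : ℕ, (x : ℝ) ≤ hi → lo ≤ (y : ℝ) → (z : ℝ) ≤ N →
      μ ≤ (1 - (p : ℝ)) ^ x * (1 - (1 - (p : ℝ)) ^ y) * (Fintype.card V - z)) :
    (SimpleGraph.binomialRandom V p).real
      {G | (((expand G)^[m + 1] {u}).card : ℝ) ≤ hi ∧
        lo ≤ ((ballDiff G u v (m + 1) \ ((expand G)^[m] {u} ∪ (expand G)^[m] {v})).card : ℝ) ∧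
        (((expand G)^[m + 1] {u} ∪ (expand G)^[m + 1] {v}).card : ℝ) ≤ N ∧
        ((freshSphere G u v (m + 1)).card : ℝ) ≤ (1 - δ) * μ} ≤
      Real.exp (-(δ ^ 2 * μ / 2)) := by
  -- A value `a` is an arbitrary tuple of sets, not necessarily nested like balls; the extra unions
  -- with `a.1.1 ∪ a.1.2` replace the nesting.
  let R : Set ((Finset V × Finset V) × Finset V × Finset V) := {a |
    ((a.2.1).card : ℝ) ≤ hi ∧ lo ≤ (((a.2.2 \ a.2.1) \ (a.1.1 ∪ a.1.2)).card : ℝ) ∧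
      ((a.2.1 ∪ a.2.2 ∪ (a.1.1 ∪ a.1.2)).card : ℝ) ≤ N}
  let F : (Finset V × Finset V) × Finset V × Finset V → Set (SimpleGraph V) := fun a =>
    {G | ((linked G (a.2.1 \ (a.1.1 ∪ a.1.2)) ((a.2.2 \ a.2.1) \ (a.1.1 ∪ a.1.2))
      (a.2.1 ∪ a.2.2 ∪ (a.1.1 ∪ a.1.2))ᶜ).card : ℝ) ≤ (1 - δ) * μ}
  refine le_trans (measureReal_mono ?_ (measure_ne_top _ _)) (measure_exploration_le
    (exploration u v m) R F (fun a => touching (a.1.1 ∪ a.1.2))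
    (fun a => (touching (a.1.1 ∪ a.1.2))ᶜ) (determinedBy_exploration u v m) ?_
    (fun a => disjoint_compl_right) (Real.exp_pos _).le ?_)
  · rintro G ⟨h1, h2, h3, h4⟩
    have hsub : (expand G)^[m + 1] {u} ∪ (expand G)^[m + 1] {v} ∪
        ((expand G)^[m] {u} ∪ (expand G)^[m] {v}) =
        (expand G)^[m + 1] {u} ∪ (expand G)^[m + 1] {v} :=
      Finset.union_eq_left.2 (Finset.union_subset_union
        (iterate_expand_subset G _ (Nat.le_succ m)) (iterate_expand_subset G _ (Nat.le_succ m)))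
    refine ⟨⟨h1, h2, ?_⟩, le_trans ?_ h4⟩
    · simp only [exploration]
      rw [hsub]
      exact h3
    · refine Nat.cast_le.2 (Finset.card_le_card ?_)
      simp only [exploration]
      exact linked_subset_freshSphere G u v m _ (by rw [hsub])
  · intro a G G' h
    have : linked G (a.2.1 \ (a.1.1 ∪ a.1.2)) ((a.2.2 \ a.2.1) \ (a.1.1 ∪ a.1.2))
        (a.2.1 ∪ a.2.2 ∪ (a.1.1 ∪ a.1.2))ᶜ =
        linked G' (a.2.1 \ (a.1.1 ∪ a.1.2)) ((a.2.2 \ a.2.1) \ (a.1.1 ∪ a.1.2))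
        (a.2.1 ∪ a.2.2 ∪ (a.1.1 ∪ a.1.2))ᶜ := by
      refine Finset.filter_congr fun w hw => determinedBy_linkEvent _ _ w G G' fun e he => h e ?_
      simp only [star, Finset.mem_image] at he
      obtain ⟨x, hx, rfl⟩ := he
      simp only [touching, Finset.mem_compl, Finset.mem_filter, Finset.mem_univ, true_and,
        not_exists, not_and, Sym2.mem_iff]
      rintro z hz (rfl | rfl)
      · simp only [Finset.mem_union, Finset.mem_sdiff] at hx hz
        tauto
      · simp only [Finset.mem_compl, Finset.mem_union] at hw hz
        tauto
    simp only [F, Set.mem_ofPred_eq, this]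
  · rintro a ⟨h1, h2, h3⟩
    refine measure_card_linked_le ?_ ?_ ?_ hδ hμ0 ?_
    · refine Finset.disjoint_left.2 fun x hx hx' => ?_
      simp only [Finset.mem_sdiff] at hx hx'
      tauto
    · refine Finset.disjoint_left.2 fun x hx hx' => ?_
      simp only [Finset.mem_sdiff, Finset.mem_compl, Finset.mem_union] at hx hx'
      tauto
    · refine Finset.disjoint_left.2 fun x hx hx' => ?_
      simp only [Finset.mem_sdiff, Finset.mem_compl, Finset.mem_union] at hx hx'
      tauto
    · rw [Finset.card_compl, Nat.cast_sub (Finset.card_le_univ _)]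
      refine hμ _ _ _ (le_trans ?_ h1) h2 h3
      exact_mod_cast Finset.card_le_card Finset.sdiff_subset

end Exploration

/-! ### Numerical bounds for fixed `n`, with `i = m + 2`. -/

/-- The numerical relations, at a single number `n` of vertices, between the average degree `d`, the
radius `m + 2` and the density `c` of the corresponding balls, with error parameter `η`. -/
structure Regime (n : ℕ) (p : unitInterval) (d c : ℝ) (m : ℕ) (η : ℝ) : Prop where
  η_pos : 0 < η
  η_le : η ≤ 1 / 30
  five_le_log : 5 ≤ Real.log n
  d_eq : d = p * n
  c_eq : c = d ^ (m + 2) / n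
  c_le : c ≤ 3 * Real.log n
  le_d : 1000 * Real.log n ^ 3 ≤ η ^ 2 * d
  radius_le : (m + 2) * Real.log d ≤ 2 * Real.log n

namespace Regime

variable {n : ℕ} {p : unitInterval} {d c η : ℝ} {m : ℕ}

section Numbers

variable (h : Regime n p d c m η)
include h

lemma n_pos : (0 : ℝ) < n := by
  rcases Nat.eq_zero_or_pos n with rfl | hn
  · have := h.five_le_log; simp at this; linarith
  · exact_mod_cast hn

lemma le_mul_d : 1000 * Real.log n ^ 3 ≤ η * d := by
  have h1 := h.le_d
  have h2 := h.η_pos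
  have h3 := h.η_le
  have h5 := h.five_le_log
  have hd : 0 < d := by
    by_contra! hd
    have : 0 < Real.log n ^ 3 := by positivity
    nlinarith [sq_nonneg η]
  nlinarith [mul_pos h2 hd]

lemma large_d : 30000 * Real.log n ^ 3 ≤ d := by
  have h1 := h.le_mul_d
  have h2 := h.η_pos
  have h3 := h.η_le
  have h5 := h.five_le_log
  have hd : 0 < d := by
    by_contra! hd
    have : 0 < Real.log n ^ 3 := by positivity
    nlinarith
  nlinarith

lemma mul_log_sq_le : 5000 * Real.log n ^ 2 ≤ η * d := by
  have h1 := h.le_mul_d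
  have h5 := h.five_le_log
  nlinarith [sq_nonneg (Real.log n)]

lemma mul_log_le : 25000 * Real.log n ≤ η * d := by
  have h1 := h.mul_log_sq_le
  have h5 := h.five_le_log
  nlinarith

lemma d_pos : 0 < d := by
  have h1 := h.large_d
  have h5 := h.five_le_log
  have : 0 < Real.log n ^ 3 := by positivity
  linarith

lemma hundred_le_d : 100 ≤ d := by
  have h1 := h.mul_log_le
  have h5 := h.five_le_log
  have h3 := h.η_le
  have h2 := h.d_pos
  nlinarith

lemma one_le_log_d : 1 ≤ Real.log d := by
  rw [Real.le_log_iff_exp_le h.d_pos]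
  have := Real.exp_one_lt_d9
  have := h.hundred_le_d
  linarith

lemma c_pos : 0 < c := by
  rw [h.c_eq]
  have := h.d_pos
  have := h.n_pos
  positivity

lemma pow_succ_eq : d ^ (m + 1) = c * n / d := by
  have := h.d_pos.ne'
  have := h.n_pos.ne'
  rw [h.c_eq, pow_succ]
  field_simp
  ring

lemma pow_eq : d ^ m = c * n / d ^ 2 := by
  have := h.d_pos.ne'
  have := h.n_pos.ne'
  rw [h.c_eq, pow_add]
  field_simp

lemma sq_le : d ^ 2 ≤ 3 * Real.log n * n := by
  have h1 : d ^ 2 ≤ d ^ (m + 2) :=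
    pow_le_pow_right₀ (by linarith [h.hundred_le_d]) (by omega)
  have h2 : d ^ (m + 2) = c * n := by
    rw [h.c_eq]; have := h.n_pos.ne'; field_simp
  have := mul_le_mul_of_nonneg_right h.c_le h.n_pos.le
  linarith

lemma error_pos : 0 < η / Real.log n := by
  have := h.η_pos
  have := h.five_le_log
  positivity

lemma error_le : η / Real.log n ≤ 1 / 150 := by
  have := h.η_le
  have := h.five_le_log
  rw [div_le_iff₀ (by linarith)]
  linarith

/-- The radius is at most `2 log n / log d`, so an error `η / log n` per level accumulates to `2 η /
log d`. -/
lemma radius_mul_error_le {j : ℕ} (hj : j ≤ m + 2) :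
    j * (η / Real.log n) ≤ 2 * η / Real.log d := by
  have h1 := h.five_le_log
  have h2 := h.one_le_log_d
  have h3 := h.η_pos
  have hj' : (j : ℝ) ≤ m + 2 := by exact_mod_cast hj
  rw [← mul_div_assoc, div_le_div_iff₀ (by linarith) (by linarith)]
  have h4 := h.radius_le
  have : (j : ℝ) * Real.log d ≤ 2 * Real.log n := by nlinarith
  nlinarith

lemma two_mul_div_log_le : 2 * η / Real.log d ≤ 2 * η := by
  have h2 := h.one_le_log_d
  have h3 := h.η_pos
  rw [div_le_iff₀ (by linarith)]
  nlinarith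

/-- The error `η / log d`, sharper than `η`, is kept because ball sizes enter an exponent: there the
size is multiplied by `p` to give about `c`, and for `c ≤ log d` the additive error is then only `4
η`. -/
lemma upper_pow_le {j : ℕ} (hj : j ≤ m + 2) :
    ((1 + η / Real.log n) * d) ^ j ≤ (1 + 4 * η / Real.log d) * d ^ j := by
  have h1 := h.error_pos
  have h2 := h.radius_mul_error_le hj
  have h3 := h.two_mul_div_log_le
  have h4 := h.η_le
  have h5 := h.one_le_log_d
  have h6 := h.η_pos
  have h7 := h.d_pos
  rw [mul_pow]
  gcongr
  calc (1 + η / Real.log n) ^ j ≤ Real.exp (η / Real.log n) ^ j := by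
        gcongr
        linarith [Real.add_one_le_exp (η / Real.log n)]
    _ = Real.exp (j * (η / Real.log n)) := by rw [← Real.exp_nat_mul]
    _ ≤ Real.exp (2 * η / Real.log d) := Real.exp_le_exp.2 h2
    _ ≤ 1 + 2 * (2 * η / Real.log d) := exp_le_one_add_two_mul (by positivity) (by linarith)
    _ = _ := by ring

lemma upper_factor_le : 1 + 4 * η / Real.log d ≤ 1 + 4 * η := by
  have := h.two_mul_div_log_le
  have h2 : 4 * η / Real.log d = 2 * (2 * η / Real.log d) := by ring
  linarith

lemma lower_pow_ge {j : ℕ} (hj : j ≤ m + 2) :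
    (1 - 2 * η) * d ^ j ≤ ((1 - η / Real.log n) * d) ^ j := by
  have h1 := h.error_le
  have h2 := h.radius_mul_error_le hj
  have h3 := h.two_mul_div_log_le
  have h7 := h.d_pos
  rw [mul_pow]
  gcongr
  have := one_add_mul_le_pow (a := -(η / Real.log n)) (by linarith) j
  calc 1 - 2 * η ≤ 1 + j * (-(η / Real.log n)) := by linarith
    _ ≤ _ := by rwa [← sub_eq_add_neg] at this

lemma c_div_d_le : 1000 * (c / d) ≤ η / Real.log n := by
  have h1 := h.c_le
  have h2 := h.le_mul_d
  have h3 := h.five_le_log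
  have h4 := h.d_pos
  have h5 := h.mul_log_sq_le
  rw [← mul_div_assoc, div_le_div_iff₀ h4 (by linarith)]
  have : 0 < Real.log n ^ 2 := by positivity
  nlinarith

end Numbers

end Regime

/-! ### Sizes of balls, and failure probabilities for fixed `n`. -/

lemma card_expand_le_mul {V : Type*} [Fintype V] [DecidableEq V] {G : SimpleGraph V} {D : ℝ}
    (hD0 : 0 ≤ D) (hD : ∀ v, ((expand G {v}).card : ℝ) ≤ D) (A : Finset V) :
    ((expand G A).card : ℝ) ≤ D * A.card := by
  have := card_expand_le_of_singleton (G := G) (D := ⌊D⌋₊) (fun v => Nat.le_floor (hD v)) A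
  calc ((expand G A).card : ℝ) ≤ ((⌊D⌋₊ * A.card : ℕ) : ℝ) := by exact_mod_cast this
    _ = ⌊D⌋₊ * A.card := by push_cast; rfl
    _ ≤ _ := by gcongr; exact Nat.floor_le hD0

/-- All neighbourhoods have at most about the expected size `d`, and all small sets expand by a
factor of at least about `d`. -/
def Expands {n : ℕ} (G : SimpleGraph (Fin n)) (d η : ℝ) (m : ℕ) : Prop :=
  (∀ v, ((expand G {v}).card : ℝ) ≤ (1 + η / Real.log n) * d) ∧
    ∀ A : Finset (Fin n), A.Nonempty → (A.card : ℝ) ≤ 4 * d ^ m →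
      (1 - η / Real.log n) * d * A.card ≤ ((expand G A).card : ℝ)

namespace Regime

open MeasureTheory

variable {n : ℕ} {p : unitInterval} {d c η : ℝ} {m : ℕ}

section Sizes

variable {G : SimpleGraph (Fin n)}

lemma card_ball_le (h : Regime n p d c m η) (hG : Expands G d η m) (u : Fin n) {j : ℕ}
    (hj : j ≤ m + 2) :
    (((expand G)^[j] {u}).card : ℝ) ≤ (1 + 4 * η / Real.log d) * d ^ j := by
  have hD0 : 0 ≤ (1 + η / Real.log n) * d := by
    have := h.error_pos; have := h.d_pos; positivity
  have := card_iterate_expand_le hD0 (card_expand_le_mul hD0 hG.1) {u} j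
  simp only [Finset.card_singleton, Nat.cast_one, mul_one] at this
  exact this.trans (h.upper_pow_le hj)

lemma card_ball_le' (h : Regime n p d c m η) (hG : Expands G d η m) (u : Fin n) {j : ℕ}
    (hj : j ≤ m + 2) :
    (((expand G)^[j] {u}).card : ℝ) ≤ (1 + 4 * η) * d ^ j := by
  have := h.d_pos
  exact (h.card_ball_le hG u hj).trans
    (mul_le_mul_of_nonneg_right h.upper_factor_le (by positivity))

/-- The loss is `2 (1 - 2 η) - (1 + 4 η) = 1 - 8 η`: the ball around the pair minus the ball around
`u`. -/
lemma card_ballDiff_ge (h : Regime n p d c m η) (hG : Expands G d η m) {u v : Fin n}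
    (huv : u ≠ v) : (1 - 8 * η) * d ^ (m + 1) ≤ ((ballDiff G u v (m + 1)).card : ℝ) := by
  have hd := h.d_pos
  have hη := h.η_le
  have hη0 := h.η_pos
  have he := h.error_pos
  have he' := h.error_le
  have hdn := h.hundred_le_d
  have hD0 : 0 ≤ (1 + η / Real.log n) * d := by positivity
  have hcard : ((({u, v} : Finset (Fin n)).card : ℕ) : ℝ) = 2 := by
    rw [Finset.card_pair huv]; norm_num
  have hlow := card_iterate_expand_ge (G := G) (D := (1 + η / Real.log n) * d)
    (K := (1 - η / Real.log n) * d) (M := 4 * d ^ m) (by nlinarith)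
    (mul_nonneg (by linarith) hd.le) (card_expand_le_mul hD0 hG.1) hG.2
    -- The threshold `4 d ^ m` leaves room for the two balls of radius `m`, of total size at most `2
    -- (1 + 4 η) d ^ m`.
    (A := {u, v}) ⟨u, by simp⟩ (m := m) (by
      rw [hcard]
      have h1 := h.upper_pow_le (j := m) (by omega)
      have h2 := mul_le_mul_of_nonneg_right h.upper_factor_le (pow_nonneg hd.le m)
      nlinarith [pow_pos hd m]) (j := m + 1) le_rfl
  rw [hcard] at hlow
  have hp := h.lower_pow_ge (j := m + 1) (by omega)
  have h3 : (((expand G)^[m + 1] {u, v}).card : ℝ) ≤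
      ((expand G)^[m + 1] {u}).card + (ballDiff G u v (m + 1)).card := by
    exact_mod_cast LocalizationGame.card_ballDiff_ge G u v (m + 1)
  have h4 := h.card_ball_le' hG u (j := m + 1) (by omega)
  linarith

lemma card_ballDiff_sdiff_ge (h : Regime n p d c m η) (hG : Expands G d η m) {u v : Fin n}
    (huv : u ≠ v) : (1 - 9 * η) * d ^ (m + 1) ≤
      ((ballDiff G u v (m + 1) \ ((expand G)^[m] {u} ∪ (expand G)^[m] {v})).card : ℝ) := by
  have h1 := h.card_ballDiff_ge hG huv
  have h2 : ((ballDiff G u v (m + 1)).card : ℝ) ≤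
      (ballDiff G u v (m + 1) \ ((expand G)^[m] {u} ∪ (expand G)^[m] {v})).card +
        (((expand G)^[m] {u}).card + ((expand G)^[m] {v}).card) := by
    have h3 := Finset.card_le_card_sdiff_add_card 
      (t := (expand G)^[m] {u} ∪ (expand G)^[m] {v}) (s := ballDiff G u v (m + 1))
    have h4 := Finset.card_union_le ((expand G)^[m] {u}) ((expand G)^[m] {v})
    exact_mod_cast h3.trans (Nat.add_le_add_left h4 _)
  have h5 := h.card_ball_le' hG u (j := m) (by omega)
  have h6 := h.card_ball_le' hG v (j := m) (by omega)
  have h7 := h.η_le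
  have h8 : 3 ≤ η * d := by linarith [h.mul_log_le, h.five_le_log]
  have h9 : 3 * d ^ m ≤ η * d ^ (m + 1) := by
    have := mul_le_mul_of_nonneg_right h8 (pow_pos h.d_pos m).le
    calc _ ≤ _ := this
      _ = _ := by ring
  have h10 := pow_pos h.d_pos m
  nlinarith

lemma card_union_ball_le (h : Regime n p d c m η) (hG : Expands G d η m) (u v : Fin n) :
    (((expand G)^[m + 1] {u} ∪ (expand G)^[m + 1] {v}).card : ℝ) ≤ η * n := by
  have h1 : (((expand G)^[m + 1] {u} ∪ (expand G)^[m + 1] {v}).card : ℝ) ≤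
      ((expand G)^[m + 1] {u}).card + ((expand G)^[m + 1] {v}).card := by
    exact_mod_cast Finset.card_union_le _ _
  have h5 := h.card_ball_le' hG u (j := m + 1) (by omega)
  have h6 := h.card_ball_le' hG v (j := m + 1) (by omega)
  have h7 := h.η_le
  have hη := h.η_pos
  have h8 : d ^ (m + 1) = c / d * n := by rw [h.pow_succ_eq]; ring
  have h9 := h.c_div_d_le
  have h10 : η / Real.log n ≤ η := div_le_self hη.le (by linarith [h.five_le_log])
  have hn := h.n_pos
  have hcd : 0 < c / d := div_pos h.c_pos h.d_pos
  have h11 : 3 * (c / d) ≤ η := by linarith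
  rw [h8] at h5 h6
  have h12 := mul_le_mul_of_nonneg_right h11 hn.le
  have h13 : 0 < c / d * n := by positivity
  nlinarith

end Sizes

section Probability

lemma exp_neg_three_log (h : Regime n p d c m η) :
    Real.exp (-(3 * Real.log n)) = ((n : ℝ) ^ 3)⁻¹ := by
  rw [Real.exp_neg, ← Real.log_rpow h.n_pos, Real.exp_log (by have := h.n_pos; positivity)]
  norm_cast

lemma c_div_d_pos (h : Regime n p d c m η) : 0 < c / d := div_pos h.c_pos h.d_pos

/-- This uses the full strength of `log³ n ≪ d`: the Chernoff exponent for relative error `η / log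
n` has to beat union bounds over vertices and small sets. -/
lemma error_sq_mul_d (h : Regime n p d c m η) :
    1000 * Real.log n ≤ (η / Real.log n) ^ 2 * d := by
  have h1 := h.le_d
  have h2 := h.five_le_log
  rw [div_pow, div_mul_eq_mul_div, le_div_iff₀ (by positivity)]
  nlinarith

lemma measure_large_neighbourhood_le (h : Regime n p d c m η) :
    (SimpleGraph.binomialRandom (Fin n) p).real
      {G | ¬ ∀ v, ((expand G {v}).card : ℝ) ≤ (1 + η / Real.log n) * d} ≤ n * ((n : ℝ) ^ 3)⁻¹ := by
  have he := h.error_pos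
  have he1 := h.error_le
  have hd := h.d_pos
  have hL := h.five_le_log
  -- Half of the error goes to Chernoff; the other half absorbs the centre of the neighbourhood.
  have key := measure_exists_large_expand_le (V := Fin n) (p := p) (δ := η / Real.log n / 2)
    (by positivity) (by linarith)
  simp only [Fintype.card_fin, ← h.d_eq] at key
  have h1 := h.error_sq_mul_d
  refine le_trans (measureReal_mono ?_ (measure_ne_top _ _)) (key.trans ?_)
  · intro G hG
    simp only [Set.mem_ofPred_eq, not_forall, not_le] at hG ⊢
    obtain ⟨v, hv⟩ := hG
    refine ⟨v, le_trans ?_ hv.le⟩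
    have : 2 ≤ η / Real.log n * d := by nlinarith
    linarith
  · gcongr
    rw [← h.exp_neg_three_log]
    refine Real.exp_le_exp.2 ?_
    nlinarith

lemma measure_small_expansion_le (h : Regime n p d c m η) :
    (SimpleGraph.binomialRandom (Fin n) p).real
      {G | ¬ ∀ A : Finset (Fin n), A.Nonempty → (A.card : ℝ) ≤ 4 * d ^ m →
        (1 - η / Real.log n) * d * A.card ≤ ((expand G A).card : ℝ)} ≤
      (1 + ((n : ℝ) ^ 3)⁻¹) ^ n - 1 := by
  have he := h.error_pos
  have he1 := h.error_le
  have hd := h.d_pos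
  have hL := h.five_le_log
  have hn := h.n_pos
  have h1 := h.error_sq_mul_d
  have hcd := h.c_div_d_le
  set θ := η / Real.log n with hθ
  -- The error is shared between the mean and the deviation, as `(1 - θ / 2)² ≥ 1 - θ`.
  have key := measure_exists_small_expand_le (V := Fin n) (p := p) (δ := θ / 2)
    (κ := (1 - θ / 2) * d) (r := ((n : ℝ) ^ 3)⁻¹) (M := 4 * d ^ m) (by positivity)
    (mul_nonneg (by linarith) hd.le) ?_ ?_
  · simp only [Fintype.card_fin] at key
    refine le_trans (measureReal_mono ?_ (measure_ne_top _ _)) key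
    intro G hG
    simp only [Set.mem_ofPred_eq, not_forall, not_le] at hG ⊢
    obtain ⟨A, hA, hAM, hlt⟩ := hG
    refine ⟨A, hA, hAM, hlt.le.trans ?_⟩
    have : 0 ≤ d * (A.card : ℝ) := by positivity
    nlinarith [sq_nonneg θ]
  · intro a ha haM
    rw [Fintype.card_fin]
    have ha0 : (0 : ℝ) < a := by exact_mod_cast ha
    have hpow : d ^ m = c / d * n / d := by rw [h.pow_eq]; field_simp
    have hp0 : (0 : ℝ) ≤ p := p.2.1
    have hp : (p : ℝ) = d / n := by rw [h.d_eq]; field_simp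
    have hcn := h.c_div_d_pos
    -- A set of at most `4 d ^ m` vertices has `p a ≤ 4 c / d`, so the neighbourhoods of its
    -- elements hardly overlap.
    have hpa : (p : ℝ) * a ≤ θ / 2 := by
      rw [hp]
      calc d / n * a ≤ d / n * (4 * d ^ m) := by gcongr
        _ = 4 * (c / d) := by rw [hpow]; field_simp
        _ ≤ _ := by linarith
    have han : a ≤ θ / 4 * n := by
      have h100 := h.hundred_le_d
      calc (a : ℝ) ≤ 4 * d ^ m := haM
        _ = 4 * (c / d) / d * n := by rw [hpow]; ring
        _ ≤ 4 * (c / d) * n := by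
            gcongr
            exact div_le_self (by positivity) (by linarith)
        _ ≤ _ := by gcongr; linarith
    have hpa0 : 0 ≤ p * (a : ℝ) := by positivity
    have h2 : (p : ℝ) * a * (1 - θ / 4) ≤ 1 - (1 - (p : ℝ)) ^ a := by
      have := one_sub_pow_le_exp p.2.2 a
      have := exp_neg_le_quadratic hpa0
      nlinarith
    have h3 : (1 - θ / 4) * n ≤ n - a := by linarith
    have hda : d * a = p * a * n := by rw [h.d_eq]; ring
    calc (1 - θ / 2) * d * a = (1 - θ / 2) * (p * a * n) := by rw [← hda]; ring
      _ ≤ (1 - θ / 4) ^ 2 * (p * a * n) := by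
          gcongr
          nlinarith [sq_nonneg θ]
      _ = p * a * (1 - θ / 4) * ((1 - θ / 4) * n) := by ring
      _ ≤ _ := by
          gcongr
          · exact mul_nonneg (by linarith) hn.le
          · refine le_trans ?_ h2
            exact mul_nonneg hpa0 (by linarith)
  · rw [← h.exp_neg_three_log]
    refine Real.exp_le_exp.2 ?_
    have : 0 ≤ θ ^ 2 * d := by positivity
    nlinarith

/-- The number of vertices that are far from `v` and not from `u` is about `n e⁻ᶜ (1 - e⁻ᶜ)`, which
is large. -/
lemma log_le_of_c_le (h : Regime n p d c m η) (hcd : c ≤ Real.log d)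
    (hc : 1 ≤ Real.log n * (1 - Real.exp (-c))) :
    12 * Real.log n ≤ η ^ 2 * (n * Real.exp (-c) * (1 - Real.exp (-c))) := by
  have hL := h.five_le_log
  have hd := h.d_pos
  have hn := h.n_pos
  -- Since `d² ≤ 3 n log n`, the factor `n e^{-c} ≥ n / d` is at least `d / (3 log n)`. With `1 -
  -- e^{-c} ≥ 1 / log n` the product is at least `d / (3 log² n)`, so `log³ n ≪ d` is again what is
  -- needed.
  have h1 : d⁻¹ ≤ Real.exp (-c) := by
    rw [← Real.exp_log hd, ← Real.exp_neg]
    exact Real.exp_le_exp.2 (neg_le_neg hcd)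
  have h2 : (Real.log n)⁻¹ ≤ 1 - Real.exp (-c) := by
    rw [inv_le_iff_one_le_mul₀ (by linarith)]; linarith
  have h3 := h.sq_le
  have h4 : d / (3 * Real.log n) ≤ n * d⁻¹ := by
    rw [← div_eq_mul_inv, div_le_div_iff₀ (by positivity) hd]
    nlinarith
  calc 12 * Real.log n ≤ η ^ 2 * (d / (3 * Real.log n) * (Real.log n)⁻¹) := by
        have h5 := h.le_d
        have : η ^ 2 * (d / (3 * Real.log n) * (Real.log n)⁻¹) =
            η ^ 2 * d / (3 * Real.log n ^ 2) := by field_simp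
        rw [this, le_div_iff₀ (by positivity)]
        nlinarith [pow_pos (show 0 < Real.log n by linarith) 3]
    _ ≤ η ^ 2 * (n * Real.exp (-c) * (1 - Real.exp (-c))) := by
        gcongr
        exact h4.trans (by gcongr)

/-- The three factors (no neighbour near `u`, some neighbour near `v`, being outside the balls) lose
`5 η`, `9 η` and `η`. -/
lemma mean_le (h : Regime n p d c m η) (hcd : c ≤ Real.log d) {x y z : ℕ}
    (hx : (x : ℝ) ≤ (1 + 4 * η / Real.log d) * d ^ (m + 1))
    (hy : (1 - 9 * η) * d ^ (m + 1) ≤ (y : ℝ)) (hz : (z : ℝ) ≤ η * n) :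
    (1 - 15 * η) * (n * Real.exp (-c) * (1 - Real.exp (-c))) ≤
      (1 - (p : ℝ)) ^ x * (1 - (1 - (p : ℝ)) ^ y) * (n - z) := by
  have hL := h.five_le_log
  have hd := h.d_pos
  have hn := h.n_pos
  have hη := h.η_pos
  have hη1 := h.η_le
  have hc := h.c_pos
  have hlogd := h.one_le_log_d
  have hp : (p : ℝ) = d / n := by rw [h.d_eq]; field_simp
  have hp0 : (0 : ℝ) < p := by rw [hp]; positivity
  have hpd : (p : ℝ) * d ^ (m + 1) = c := by rw [hp, h.pow_succ_eq]; field_simp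
  have hpL : (p : ℝ) * (4 * Real.log n) ≤ η := by
    rw [hp, div_mul_eq_mul_div, div_le_iff₀ hn]
    have h1 := h.sq_le
    have h2 := h.mul_log_sq_le
    refine le_of_mul_le_mul_right ?_ hd
    calc d * (4 * Real.log n) * d = d ^ 2 * (4 * Real.log n) := by ring
      _ ≤ 3 * Real.log n * n * (4 * Real.log n) := by gcongr
      _ = 12 * Real.log n ^ 2 * n := by ring
      _ ≤ η * d * n := by
          refine mul_le_mul_of_nonneg_right ?_ hn.le
          nlinarith [sq_nonneg (Real.log n)]
      _ = _ := by ring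
  have hp1 : (p : ℝ) < 1 := by nlinarith
  have hpx : p * (x : ℝ) ≤ c + 4 * η := by
    calc p * (x : ℝ) ≤ p * ((1 + 4 * η / Real.log d) * d ^ (m + 1)) := by gcongr
      _ = (1 + 4 * η / Real.log d) * (p * d ^ (m + 1)) := by ring
      _ = c + 4 * η * (c / Real.log d) := by rw [hpd]; ring
      _ ≤ c + 4 * η * 1 := by
          gcongr
          rw [div_le_one (by linarith)]; exact hcd
      _ = _ := by ring
  -- The step from `4 η` to `5 η` pays for replacing `p` by `p / (1 - p)`; `hpL` makes this
  -- affordable.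
  have hA : Real.exp (-(c + 5 * η)) ≤ (1 - (p : ℝ)) ^ x := by
    refine le_trans (Real.exp_le_exp.2 (neg_le_neg ?_)) (exp_le_one_sub_pow hp1 x)
    rw [div_le_iff₀ (by linarith)]
    have : (p : ℝ) * (c + 5 * η) ≤ η := by
      refine le_trans ?_ hpL
      gcongr
      linarith [h.c_le]
    linarith
  have hA' : (1 - 5 * η) * Real.exp (-c) ≤ (1 - (p : ℝ)) ^ x := by
    refine le_trans ?_ hA
    rw [neg_add, Real.exp_add, mul_comm]
    gcongr
    have := Real.one_sub_le_exp_neg (5 * η)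
    linarith
  have hB : (1 - 9 * η) * (1 - Real.exp (-c)) ≤ 1 - (1 - (p : ℝ)) ^ y := by
    refine (mul_one_sub_exp_le (by linarith) (by linarith)).trans ?_
    have h1 := one_sub_pow_le_exp hp1.le y
    have h2 : c * (1 - 9 * η) ≤ p * y := by
      rw [← hpd]
      calc _ = (p : ℝ) * ((1 - 9 * η) * d ^ (m + 1)) := by ring
        _ ≤ _ := by gcongr
    have h3 := Real.exp_le_exp.2 (neg_le_neg h2)
    linarith
  have hC : (1 - η) * n ≤ n - z := by linarith
  have hec : 0 < Real.exp (-c) := Real.exp_pos _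
  have hec1 : 0 ≤ 1 - Real.exp (-c) := by
    have := Real.exp_le_one_iff.2 (neg_nonpos.2 hc.le); linarith
  calc (1 - 15 * η) * (n * Real.exp (-c) * (1 - Real.exp (-c)))
      ≤ ((1 - 5 * η) * (1 - 9 * η) * (1 - η)) * (n * Real.exp (-c) * (1 - Real.exp (-c))) := by
        gcongr
        nlinarith [mul_pos hη hη]
    _ = ((1 - 5 * η) * Real.exp (-c)) * ((1 - 9 * η) * (1 - Real.exp (-c))) * ((1 - η) * n) := by
        ring
    _ ≤ _ := by
        have h1 : 0 ≤ (1 - 5 * η) * Real.exp (-c) := mul_nonneg (by linarith) hec.le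
        have h2 : 0 ≤ (1 - 9 * η) * (1 - Real.exp (-c)) := mul_nonneg (by linarith) hec1
        have h3 : 0 ≤ (1 - η) * n := mul_nonneg (by linarith) hn.le
        exact mul_le_mul (mul_le_mul hA' hB h2 (h1.trans hA')) hC h3
          (mul_nonneg (h1.trans hA') (h2.trans hB))

lemma measure_small_freshSphere_le (h : Regime n p d c m η) (hcd : c ≤ Real.log d)
    (hc : 1 ≤ Real.log n * (1 - Real.exp (-c))) :
    (SimpleGraph.binomialRandom (Fin n) p).real
      {G | Expands G d η m ∧ ¬ ∀ u v, u ≠ v →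
        (1 - 16 * η) * (n * Real.exp (-c) * (1 - Real.exp (-c))) ≤
          ((freshSphere G u v (m + 1)).card : ℝ)} ≤ n ^ 2 * ((n : ℝ) ^ 3)⁻¹ := by
  set g := n * Real.exp (-c) * (1 - Real.exp (-c)) with hg
  have hη := h.η_pos
  have hη1 := h.η_le
  have hlog := h.log_le_of_c_le hcd hc
  rw [← hg] at hlog
  have hL := h.five_le_log
  have hg0 : 0 ≤ g := by
    by_contra! hneg
    nlinarith [sq_nonneg η]
  have hμ0 : 0 ≤ (1 - 15 * η) * g := mul_nonneg (by linarith) hg0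
  let Bad : Fin n → Fin n → Set (SimpleGraph (Fin n)) := fun u v =>
    {G | (((expand G)^[m + 1] {u}).card : ℝ) ≤ (1 + 4 * η / Real.log d) * d ^ (m + 1) ∧
        (1 - 9 * η) * d ^ (m + 1) ≤
          ((ballDiff G u v (m + 1) \ ((expand G)^[m] {u} ∪ (expand G)^[m] {v})).card : ℝ) ∧
        (((expand G)^[m + 1] {u} ∪ (expand G)^[m + 1] {v}).card : ℝ) ≤ η * n ∧
        ((freshSphere G u v (m + 1)).card : ℝ) ≤ (1 - η) * ((1 - 15 * η) * g)}
  have hBad : ∀ u v, (SimpleGraph.binomialRandom (Fin n) p).real (Bad u v) ≤ ((n : ℝ) ^ 3)⁻¹ := by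
    intro u v
    refine (measure_card_freshSphere_le u v m hη.le hμ0 fun x y z hx hy hz => ?_).trans ?_
    · rw [Fintype.card_fin]
      exact h.mean_le hcd hx hy hz
    -- As `1 - 15 η ≥ 1/2`, the exponent is at least `η² g / 4 ≥ 3 log n`, which is where the
    -- constant 12 in `log_le_of_c_le` comes from. It beats the `n²` pairs.
    · rw [← h.exp_neg_three_log]
      refine Real.exp_le_exp.2 ?_
      have : 0 ≤ η ^ 2 * g := by positivity
      nlinarith
  have hsub : {G : SimpleGraph (Fin n) | Expands G d η m ∧ ¬ ∀ u v, u ≠ v →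
        (1 - 16 * η) * g ≤ ((freshSphere G u v (m + 1)).card : ℝ)} ⊆
      ⋃ x ∈ (Finset.univ : Finset (Fin n × Fin n)), Bad x.1 x.2 := by
    rintro G ⟨hG, hneg⟩
    push Not at hneg
    obtain ⟨u, v, huv, hlt⟩ := hneg
    simp only [Set.mem_iUnion]
    refine ⟨(u, v), Finset.mem_univ _, h.card_ball_le hG u (by omega),
      h.card_ballDiff_sdiff_ge hG huv, h.card_union_ball_le hG u v, hlt.le.trans ?_⟩
    nlinarith [mul_nonneg (sq_nonneg η) hg0]
  calc _ ≤ _ := measureReal_mono hsub (measure_ne_top _ _)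
    _ ≤ _ := measureReal_biUnion_finset_le _ _
    _ ≤ ∑ _x : Fin n × Fin n, ((n : ℝ) ^ 3)⁻¹ := Finset.sum_le_sum fun x _ => hBad _ _
    _ = _ := by simp [sq]

end Probability

end Regime

open MeasureTheory

/-! ### Asymptotically almost sure statements. -/

section AlmostSurely

variable {p : ℕ → unitInterval} {Q R S : ∀ n, SimpleGraph (Fin n) → Prop}

lemma aas_iff : AAS p Q ↔ Tendsto (fun n =>
    (SimpleGraph.binomialRandom (Fin n) (p n)).real {G | ¬ Q n G}) atTop (𝓝 0) := by
  have h1 : ∀ n, SimpleGraph.binomialRandom (Fin n) (p n) {G | Q n G} = ENNReal.ofReal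
      (1 - (SimpleGraph.binomialRandom (Fin n) (p n)).real {G | ¬ Q n G}) := by
    intro n
    have h2 : {G | ¬ Q n G} = {G | Q n G}ᶜ := rfl
    rw [h2, probReal_compl_eq_one_sub (measurableSet_of_finite_graph _), sub_sub_cancel,
      ofReal_measureReal]
  rw [AAS]
  simp only [h1]
  constructor
  · intro h
    have h3 := (ENNReal.tendsto_toReal ENNReal.one_ne_top).comp h
    have h4 : Tendsto (fun n => 1 - (1 - (SimpleGraph.binomialRandom (Fin n) (p n)).real
        {G | ¬ Q n G})) atTop (𝓝 (1 - 1)) := by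
      refine Tendsto.const_sub 1 (h3.congr fun n => ?_)
      rw [Function.comp_apply, ENNReal.toReal_ofReal]
      exact sub_nonneg.2 measureReal_le_one
    simpa using h4
  · intro h
    have := ENNReal.tendsto_ofReal (h.const_sub 1)
    simpa using this

lemma AAS.mono₂ (hQ : AAS p Q) (hR : AAS p R) (h : ∀ᶠ n in atTop, ∀ G, Q n G → R n G → S n G) :
    AAS p S := by
  rw [aas_iff] at *
  have h0 := hQ.add hR
  rw [add_zero] at h0
  refine tendsto_of_tendsto_of_tendsto_of_le_of_le' tendsto_const_nhds h0
    (Eventually.of_forall fun n => measureReal_nonneg) ?_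
  filter_upwards [h] with n hn
  refine (measureReal_mono ?_ (measure_ne_top _ _)).trans (measureReal_union_le _ _)
  intro G hG
  by_contra hcon
  simp only [Set.mem_union, Set.mem_ofPred_eq, not_or, not_not] at hcon hG
  exact hG (hn G hcon.1 hcon.2)

lemma AAS.mono (hQ : AAS p Q) (h : ∀ᶠ n in atTop, ∀ G, Q n G → S n G) : AAS p S :=
  hQ.mono₂ hQ (h.mono fun _ hn G h1 _ => hn G h1)

lemma aas_of_measureReal_le (b : ℕ → ℝ) (hb : Tendsto b atTop (𝓝 0))
    (h : ∀ᶠ n in atTop, (SimpleGraph.binomialRandom (Fin n) (p n)).real {G | ¬ Q n G} ≤ b n) :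
    AAS p Q :=
  aas_iff.2 (tendsto_of_tendsto_of_tendsto_of_le_of_le' tendsto_const_nhds hb
    (Eventually.of_forall fun _ => measureReal_nonneg) h)

/-- A bound that holds a.a.s. with every constant relative error holds with error `o(1)`. -/
lemma aasLocalizationLE_of_forall {f : ℕ → ℝ}
    (h : ∀ ε : ℝ, 0 < ε → ε ≤ 1 → AAS p fun n G => (localizationNumber G : ℝ) ≤ (1 + ε) * f n) :
    AASLocalizationLE p f := by
  let P : ℕ → ℕ → Prop := fun n j => (SimpleGraph.binomialRandom (Fin n) (p n)).real
    {G | ¬ (localizationNumber G : ℝ) ≤ (1 + 1 / ((j : ℝ) + 1)) * f n} ≤ 1 / ((j : ℝ) + 1)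
  -- Diagonal choice: the best accuracy `1 / (j + 1)`, `j ≤ n`, already reached at `n`. The case `j
  -- = 0` holds trivially, so the search never fails.
  let J : ℕ → ℕ := fun n => Nat.findGreatest (P n) n
  have hP : ∀ n, P n (J n) := by
    intro n
    refine Nat.findGreatest_spec (P := P n) (Nat.zero_le n) ?_
    simp only [P, Nat.cast_zero, zero_add, div_one]
    exact measureReal_le_one
  have hJ : Tendsto J atTop atTop := by
    rw [tendsto_atTop]
    intro j
    have hj : (0 : ℝ) < 1 / ((j : ℝ) + 1) := by positivity
    have h1 := aas_iff.1 (h (1 / ((j : ℝ) + 1)) hj (by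
      rw [div_le_one (by positivity)]; linarith [Nat.cast_nonneg (α := ℝ) j]))
    filter_upwards [h1.eventually (eventually_le_nhds hj), eventually_ge_atTop j] with n hn hjn
    exact Nat.le_findGreatest hjn hn
  have hlim : Tendsto (fun n => 1 / ((J n : ℝ) + 1)) atTop (𝓝 0) :=
    tendsto_one_div_add_atTop_nhds_zero_nat.comp hJ
  exact ⟨_, hlim, aas_of_measureReal_le _ hlim (Eventually.of_forall hP)⟩

/-- If a.a.s. every pair of vertices is distinguished by a proportion of about `2 ρ` of all sensors,
then about `log d / ρ` sensors are enough. -/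
lemma aasLocalizationLE_of_distinguishing {d ρ f : ℕ → ℝ} (hd : Tendsto d atTop atTop)
    (hρ : ∀ᶠ n in atTop, 0 < ρ n ∧ ρ n ≤ 2)
    (hf : ∀ η : ℝ, 0 < η → ∀ᶠ n in atTop, (1 - η) * Real.log (d n) ≤ ρ n * f n)
    (hG : ∀ η : ℝ, 0 < η → η ≤ 1 / 30 → AAS p fun n G =>
      (∀ v, ((expand G {v}).card : ℝ) ≤ 2 * d n) ∧
        ∀ u v, u ≠ v → 2 * (1 - 16 * η) * ρ n * n ≤ ((distinguishing G u v).card : ℝ)) :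
    AASLocalizationLE p f := by
  refine aasLocalizationLE_of_forall fun ε hε hε1 => ?_
  have hη : 0 < ε / 100 := by positivity
  refine (hG (ε / 100) hη (by linarith)).mono ?_
  have hlog : Tendsto (fun n => Real.log (d n)) atTop atTop := Real.tendsto_log_atTop.comp hd
  filter_upwards [hρ, hf _ hη, hd.eventually_gt_atTop 0, hlog.eventually_ge_atTop (14 / ε),
    eventually_gt_atTop 0] with n ⟨hρ0, hρ2⟩ hfn hd0 hlogd hn G ⟨hG1, hG2⟩
  have hlog0 : 0 < Real.log (d n) := lt_of_lt_of_le (by positivity) hlogd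
  have hf0 : 0 < f n := by
    have : 0 < ρ n * f n := lt_of_lt_of_le (mul_pos (by linarith) hlog0) hfn
    exact pos_of_mul_pos_right this hρ0.le
  have : Nonempty (Fin n) := ⟨⟨0, hn⟩⟩
  set k := ⌊(1 + ε) * f n⌋₊ with hk
  have hk1 : (1 + ε) * f n - 1 ≤ k := (Nat.sub_one_lt_floor _).le
  refine le_trans ?_ (Nat.floor_le (show 0 ≤ (1 + ε) * f n by positivity))
  refine Nat.cast_le.2 (localizationNumber_le_of_distinguishing G
    (q := 2 * (1 - 16 * (ε / 100)) * ρ n) (D := ⌊2 * d n⌋₊)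
    (card_expand_le_of_singleton fun v => Nat.le_floor (hG1 v))
    (by simpa using hG2) ?_)
  have hD : ((⌊2 * d n⌋₊ : ℕ) : ℝ) ≤ 2 * d n := Nat.floor_le (by positivity)
  -- Rounding `k` down costs at most `ρ ≤ 2`, and `ε log d ≥ 14` covers this together with the
  -- margin 3. The margin turns `D² ≤ 4 d²` into `4 e^{-3} < 1/2`.
  have hexp : 2 * Real.log (d n) + 3 ≤ 2 * (1 - 16 * (ε / 100)) * ρ n * k := by
    have hc : 0 ≤ 2 * (1 - 16 * (ε / 100)) := by linarith
    have h14 : 14 ≤ ε * Real.log (d n) := by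
      rw [div_le_iff₀ hε] at hlogd; linarith
    calc 2 * Real.log (d n) + 3
        ≤ 2 * (1 - 16 * (ε / 100)) * ((1 + ε) * ((1 - ε / 100) * Real.log (d n)) - 2) := by
          have h1 : 1 + ε / 2 ≤ (1 - 16 * (ε / 100)) * ((1 + ε) * (1 - ε / 100)) := by
            nlinarith [mul_pos hε hε]
          have h2 := mul_le_mul_of_nonneg_right h1 hlog0.le
          nlinarith
      _ ≤ 2 * (1 - 16 * (ε / 100)) * ((1 + ε) * (ρ n * f n) - ρ n) := by
          gcongr
      _ = 2 * (1 - 16 * (ε / 100)) * (ρ n * ((1 + ε) * f n - 1)) := by ring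
      _ ≤ 2 * (1 - 16 * (ε / 100)) * (ρ n * k) := by gcongr
      _ = _ := by ring
  have h8 : (8 : ℝ) < Real.exp 3 := by
    have h1 := Real.quadratic_le_exp_of_nonneg (x := 3) (by norm_num)
    linarith
  calc ((⌊2 * d n⌋₊ : ℕ) : ℝ) ^ 2 * Real.exp (-(2 * (1 - 16 * (ε / 100)) * ρ n * k))
      ≤ (2 * d n) ^ 2 * Real.exp (-(2 * Real.log (d n) + 3)) := by gcongr
    _ = 4 * (Real.exp 3)⁻¹ := by
        have : -(2 * Real.log (d n) + 3) = -Real.log (d n) + (-Real.log (d n) + -3) := by ring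
        rw [this, Real.exp_add, Real.exp_add, Real.exp_neg (Real.log (d n)), Real.exp_log hd0,
          Real.exp_neg]
        field_simp
        ring
    _ < 1 / 2 := by
        rw [← div_eq_mul_inv, div_lt_div_iff₀ (by positivity) (by norm_num)]
        linarith

end AlmostSurely

/-! ### The sequences `d`, `c`, `i` and the resulting upper bounds. -/

/-- The standing assumptions on the edge probability `p`, the expected degree `d`, the radius `i` and
the density `c`, with `c` bounded away from `0`. -/
structure GrowthAssumptions (p : ℕ → unitInterval) (i : ℕ → ℕ) (d c : ℕ → ℝ) : Prop where
  d_eq : ∀ n, d n = (p n : ℝ) * n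
  c_eq : ∀ n, c n = d n ^ i n / n
  lower : (fun n : ℕ => Real.log n ^ 3) =o[atTop] d
  upper : d =o[atTop] fun n : ℕ => (n : ℝ)
  c_ge : ∃ c₀ > 0, ∀ᶠ n in atTop, c₀ ≤ c n
  c_le : ∀ᶠ n : ℕ in atTop, c n ≤ 3 * Real.log n

lemma tendsto_log_natCast : Tendsto (fun n : ℕ => Real.log n) atTop atTop :=
  Real.tendsto_log_atTop.comp tendsto_natCast_atTop_atTop

lemma eventually_mul_log_pow_le {d : ℕ → ℝ} (hd : ∀ n, 0 ≤ d n)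
    (hd_lower : (fun n : ℕ => Real.log n ^ 3) =o[atTop] d) {K : ℝ} (hK : 0 < K) :
    ∀ᶠ n : ℕ in atTop, K * Real.log n ^ 3 ≤ d n := by
  filter_upwards [hd_lower.def (inv_pos.2 hK)] with n hn
  rw [Real.norm_eq_abs, Real.norm_of_nonneg (hd n)] at hn
  have := (le_abs_self _).trans hn
  rwa [le_inv_mul_iff₀ hK] at this

lemma tendsto_atTop_of_log_isLittleO {d : ℕ → ℝ} (hd : ∀ n, 0 ≤ d n)
    (hd_lower : (fun n : ℕ => Real.log n ^ 3) =o[atTop] d) : Tendsto d atTop atTop := by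
  refine tendsto_atTop_mono' _ (eventually_mul_log_pow_le hd hd_lower one_pos) ?_
  simpa [Function.comp_def] using
    (tendsto_pow_atTop (α := ℝ) (n := 3) (by norm_num)).comp tendsto_log_natCast

namespace GrowthAssumptions

variable {p : ℕ → unitInterval} {i : ℕ → ℕ} {d c : ℕ → ℝ}

section

variable (h : GrowthAssumptions p i d c)
include h

lemma d_nonneg (n : ℕ) : 0 ≤ d n := by
  rw [h.d_eq]
  exact mul_nonneg (p n).2.1 n.cast_nonneg

lemma tendsto_d : Tendsto d atTop atTop := tendsto_atTop_of_log_isLittleO h.d_nonneg h.lower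

lemma tendsto_log_d : Tendsto (fun n => Real.log (d n)) atTop atTop :=
  Real.tendsto_log_atTop.comp h.tendsto_d

/-- The exponents 0 and 1 would give `c = 1 / n` and `c = d / n`, both tending to `0`. -/
lemma eventually_two_le : ∀ᶠ n in atTop, 2 ≤ i n := by
  obtain ⟨c₀, hc₀, hc⟩ := h.c_ge
  have h1 : Tendsto (fun n : ℕ => 1 / (n : ℝ)) atTop (𝓝 0) := tendsto_one_div_atTop_nhds_zero_nat
  have h2 : Tendsto (fun n : ℕ => d n / n) atTop (𝓝 0) := h.upper.tendsto_div_nhds_zero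
  filter_upwards [hc, h1.eventually (gt_mem_nhds hc₀), h2.eventually (gt_mem_nhds hc₀)]
    with n hn h1 h2
  by_contra! hi
  rw [h.c_eq] at hn
  interval_cases i n
  · rw [pow_zero] at hn; linarith
  · rw [pow_one] at hn; linarith

lemma eventually_regime {η : ℝ} (hη : 0 < η) (hη1 : η ≤ 1 / 30) :
    ∀ᶠ n in atTop, 2 ≤ i n ∧ Regime n (p n) (d n) (c n) (i n - 2) η := by
  have hK : 0 < 1000 / η ^ 2 := by positivity
  filter_upwards [h.eventually_two_le, tendsto_log_natCast.eventually_ge_atTop 5, h.c_le,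
    eventually_mul_log_pow_le h.d_nonneg h.lower hK, h.tendsto_d.eventually_gt_atTop 0,
    eventually_gt_atTop 0] with n hi hL hc hd hd0 hn
  have hn0 : (0 : ℝ) < n := by exact_mod_cast hn
  have hi' : i n - 2 + 2 = i n := by omega
  refine ⟨hi, hη, hη1, hL, h.d_eq n, by rw [hi']; exact h.c_eq n, hc, ?_, ?_⟩
  · rw [div_mul_eq_mul_div, div_le_iff₀ (by positivity)] at hd
    linarith
  · have h1 : ((i n - 2 : ℕ) : ℝ) + 2 = i n := by exact_mod_cast hi'
    rw [h1, ← Real.log_pow]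
    have h2 : d n ^ i n = c n * n := by rw [h.c_eq]; field_simp
    have h3 : c n ≤ n := by
      refine hc.trans ?_
      have h4 := Real.quadratic_le_exp_of_nonneg (x := Real.log n) (by linarith)
      rw [Real.exp_log hn0] at h4
      nlinarith
    calc Real.log (d n ^ i n) ≤ Real.log ((n : ℝ) * n) := by
          refine Real.log_le_log (by positivity) ?_
          rw [h2]; gcongr
      _ = 2 * Real.log n := by rw [Real.log_mul hn0.ne' hn0.ne']; ring

lemma aas_expands {η : ℝ} (hη : 0 < η) (hη1 : η ≤ 1 / 30) :
    AAS p fun n G => Expands G (d n) η (i n - 2) := by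
  refine aas_of_measureReal_le (fun n : ℕ => 3 * (1 / (n : ℝ)))
    (by simpa using tendsto_one_div_atTop_nhds_zero_nat.const_mul (3 : ℝ)) ?_
  filter_upwards [h.eventually_regime hη hη1, eventually_ge_atTop 1] with n ⟨_, hr⟩ hn
  have hn1 : (1 : ℝ) ≤ n := by exact_mod_cast hn
  have hr3 : (n : ℝ) * ((n : ℝ) ^ 3)⁻¹ ≤ 1 / n := by
    rw [← div_eq_mul_inv, div_le_div_iff₀ (by positivity) (by positivity)]
    nlinarith [mul_nonneg (sq_nonneg (n : ℝ)) (show (0 : ℝ) ≤ n - 1 by linarith)]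
  have h2 : (1 + ((n : ℝ) ^ 3)⁻¹) ^ n - 1 ≤ 2 * (1 / (n : ℝ)) := by
    have h3 : (1 + ((n : ℝ) ^ 3)⁻¹) ^ n ≤ Real.exp (n * ((n : ℝ) ^ 3)⁻¹) := by
      rw [Real.exp_nat_mul]
      gcongr
      linarith [Real.add_one_le_exp (((n : ℝ) ^ 3)⁻¹)]
    have h4 := exp_le_one_add_two_mul (x := n * ((n : ℝ) ^ 3)⁻¹) (by positivity)
      (hr3.trans ((div_le_one (by positivity)).2 hn1))
    linarith
  have hsub : {G : SimpleGraph (Fin n) | ¬ Expands G (d n) η (i n - 2)} ⊆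
      {G | ¬ ∀ v, ((expand G {v}).card : ℝ) ≤ (1 + η / Real.log n) * d n} ∪
      {G | ¬ ∀ A : Finset (Fin n), A.Nonempty → (A.card : ℝ) ≤ 4 * d n ^ (i n - 2) →
        (1 - η / Real.log n) * d n * A.card ≤ ((expand G A).card : ℝ)} := by
    intro G hG
    by_contra hcon
    simp only [Set.mem_union, Set.mem_ofPred_eq, not_or, not_not] at hcon hG
    exact hG hcon
  calc _ ≤ _ := measureReal_mono hsub (measure_ne_top _ _)
    _ ≤ _ := measureReal_union_le _ _
    _ ≤ n * ((n : ℝ) ^ 3)⁻¹ + ((1 + ((n : ℝ) ^ 3)⁻¹) ^ n - 1) :=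
        add_le_add hr.measure_large_neighbourhood_le hr.measure_small_expansion_le
    _ ≤ _ := by linarith

lemma eventually_one_le_log_mul : ∀ᶠ n : ℕ in atTop, 1 ≤ Real.log n * (1 - Real.exp (-c n)) := by
  obtain ⟨c₀, hc₀, hc⟩ := h.c_ge
  have h1 : 0 < 1 - Real.exp (-c₀) := by
    have := Real.exp_lt_one_iff.2 (neg_lt_zero.2 hc₀); linarith
  filter_upwards [hc, tendsto_log_natCast.eventually_ge_atTop (1 / (1 - Real.exp (-c₀)))]
    with n hn hL
  have h2 := Real.exp_le_exp.2 (neg_le_neg hn)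
  have h3 : 0 < Real.log n := lt_of_lt_of_le (by positivity) hL
  rw [div_le_iff₀ h1] at hL
  nlinarith

lemma aas_freshSphere (hcd : ∀ᶠ n in atTop, c n ≤ Real.log (d n)) {η : ℝ} (hη : 0 < η)
    (hη1 : η ≤ 1 / 30) :
    AAS p fun n G => Expands G (d n) η (i n - 2) → ∀ u v, u ≠ v →
      (1 - 16 * η) * (n * Real.exp (-c n) * (1 - Real.exp (-c n))) ≤
        ((freshSphere G u v (i n - 2 + 1)).card : ℝ) := by
  refine aas_of_measureReal_le (fun n : ℕ => 1 / (n : ℝ)) tendsto_one_div_atTop_nhds_zero_nat ?_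
  filter_upwards [h.eventually_regime hη hη1, hcd, h.eventually_one_le_log_mul,
    eventually_gt_atTop 0] with n ⟨_, hr⟩ hcd hc hn
  have hn0 : (0 : ℝ) < n := by exact_mod_cast hn
  have := hr.measure_small_freshSphere_le hcd hc
  have h3 : (n : ℝ) ^ 2 * ((n : ℝ) ^ 3)⁻¹ = 1 / n := by field_simp
  rw [h3] at this
  simpa only [Classical.not_imp] using this

lemma aas_distinguishing_ballDiff {η : ℝ} (hη : 0 < η) (hη1 : η ≤ 1 / 30) :
    AAS p fun n G => (∀ v, ((expand G {v}).card : ℝ) ≤ 2 * d n) ∧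
      ∀ u v, u ≠ v → 2 * (1 - 16 * η) * (c n / d n) * n ≤ ((distinguishing G u v).card : ℝ) := by
  refine (h.aas_expands hη hη1).mono ?_
  filter_upwards [h.eventually_regime hη hη1] with n ⟨_, hr⟩ G hG
  refine ⟨fun v => (hG.1 v).trans ?_, fun u v huv => ?_⟩
  · have := hr.error_le
    have := hr.d_pos
    gcongr
    linarith
  · have h1 := hr.card_ballDiff_ge hG huv
    have h2 := hr.card_ballDiff_ge hG huv.symm
    have h3 : ((freshSphere G u v (i n - 2 + 1)).card : ℝ) +
        (freshSphere G v u (i n - 2 + 1)).card + ((ballDiff G u v (i n - 2 + 1)).card +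
        (ballDiff G v u (i n - 2 + 1)).card) ≤ (distinguishing G u v).card := by
      exact_mod_cast card_distinguishing_ge G u v (i n - 2 + 1)
    have h4 : d n ^ (i n - 2 + 1) = c n / d n * n := by rw [hr.pow_succ_eq]; ring
    rw [h4] at h1 h2
    have h5 : 0 ≤ η * (c n / d n * n) := by
      have := hr.c_div_d_pos
      have := hr.n_pos
      positivity
    have h6 : (0 : ℝ) ≤ (freshSphere G u v (i n - 2 + 1)).card := Nat.cast_nonneg _
    have h7 : (0 : ℝ) ≤ (freshSphere G v u (i n - 2 + 1)).card := Nat.cast_nonneg _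
    nlinarith

lemma aas_distinguishing (hcd : ∀ᶠ n in atTop, c n ≤ Real.log (d n)) {η : ℝ} (hη : 0 < η)
    (hη1 : η ≤ 1 / 30) :
    AAS p fun n G => (∀ v, ((expand G {v}).card : ℝ) ≤ 2 * d n) ∧
      ∀ u v, u ≠ v →
        2 * (1 - 16 * η) * (Real.exp (-c n) * (1 - Real.exp (-c n)) + c n / d n) * n ≤
          ((distinguishing G u v).card : ℝ) := by
  refine (h.aas_expands hη hη1).mono₂ (h.aas_freshSphere hcd hη hη1) ?_
  filter_upwards [h.eventually_regime hη hη1] with n ⟨_, hr⟩ G hG hF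
  replace hF := hF hG
  refine ⟨fun v => (hG.1 v).trans ?_, fun u v huv => ?_⟩
  · have := hr.error_le
    have := hr.d_pos
    gcongr
    linarith
  · have h1 := hr.card_ballDiff_ge hG huv
    have h2 := hr.card_ballDiff_ge hG huv.symm
    have h3 : ((freshSphere G u v (i n - 2 + 1)).card : ℝ) +
        (freshSphere G v u (i n - 2 + 1)).card + ((ballDiff G u v (i n - 2 + 1)).card +
        (ballDiff G v u (i n - 2 + 1)).card) ≤ (distinguishing G u v).card := by
      exact_mod_cast card_distinguishing_ge G u v (i n - 2 + 1)
    have h4 : d n ^ (i n - 2 + 1) = c n / d n * n := by rw [hr.pow_succ_eq]; ring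
    rw [h4] at h1 h2
    have h5 : 0 ≤ η * (c n / d n * n) := by
      have := hr.c_div_d_pos
      have := hr.n_pos
      positivity
    have h6 := hF u v huv
    have h7 := hF v u huv.symm
    nlinarith

lemma eventually_rate_bounds : ∀ᶠ n in atTop, (0 < c n / d n ∧ c n / d n ≤ 1) ∧
    0 < Real.exp (-c n) * (1 - Real.exp (-c n)) ∧
      Real.exp (-c n) * (1 - Real.exp (-c n)) ≤ 1 := by
  filter_upwards [h.eventually_regime (η := 1 / 30) (by norm_num) le_rfl] with n ⟨_, hr⟩
  have h1 := hr.c_div_d_le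
  have h2 := hr.error_le
  have h3 := Real.exp_lt_one_iff.2 (neg_lt_zero.2 hr.c_pos)
  have h4 := Real.exp_pos (-c n)
  exact ⟨⟨hr.c_div_d_pos, by linarith⟩, mul_pos h4 (by linarith), by nlinarith⟩

/-- The term `2 log log n` is eventually nonnegative and merely adds slack. Using `min η 1` keeps
the factor nonnegative when `η > 1`. -/
lemma eventually_mul_log_le {ρ g s : ℕ → ℝ} (hs : Tendsto s atTop (𝓝 1))
    (hsg : ∀ᶠ n in atTop, s n ≤ ρ n * g n) {η : ℝ} (hη : 0 < η) :
    ∀ᶠ n : ℕ in atTop, (1 - η) * Real.log (d n) ≤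
      ρ n * ((Real.log (d n) + 2 * Real.log (Real.log n)) * g n) := by
  have hη' : 0 < min η 1 := lt_min hη one_pos
  filter_upwards [hsg, hs.eventually (lt_mem_nhds (show 1 - min η 1 < 1 by linarith)),
    h.tendsto_log_d.eventually_ge_atTop 0, tendsto_log_natCast.eventually_ge_atTop 1]
    with n h1 h2 h3 h4
  have h5 : 0 ≤ Real.log (Real.log n) := Real.log_nonneg h4
  have h6 : 1 - η ≤ 1 - min η 1 := by linarith [min_le_left η 1]
  have h7 : 0 ≤ 1 - min η 1 := by linarith [min_le_right η 1]
  calc (1 - η) * Real.log (d n)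
      ≤ (1 - min η 1) * (Real.log (d n) + 2 * Real.log (Real.log n)) := by
        refine (mul_le_mul_of_nonneg_right h6 h3).trans (mul_le_mul_of_nonneg_left ?_ h7)
        linarith
    _ ≤ (ρ n * g n) * (Real.log (d n) + 2 * Real.log (Real.log n)) := by
        refine mul_le_mul_of_nonneg_right (h2.le.trans h1) ?_
        linarith
    _ = _ := by ring

/-- The upper bound in the range where the vertices outside the balls of radius `i` matter. -/
lemma aasLocalizationLE_of_le_log (hcd : ∀ᶠ n in atTop, c n ≤ Real.log (d n)) {g s : ℕ → ℝ}
    (hs : Tendsto s atTop (𝓝 1))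
    (hsg : ∀ᶠ n in atTop,
      s n ≤ (Real.exp (-c n) * (1 - Real.exp (-c n)) + c n / d n) * g n) :
    AASLocalizationLE p fun n => (Real.log (d n) + 2 * Real.log (Real.log n)) * g n :=
  aasLocalizationLE_of_distinguishing h.tendsto_d
    (h.eventually_rate_bounds.mono fun n hn => ⟨by linarith, by linarith⟩)
    (fun _ hη => h.eventually_mul_log_le hs hsg hη)
    (fun _ hη hη1 => h.aas_distinguishing hcd hη hη1)

/-- The upper bound obtained from the balls of radius `i - 1` alone. -/
lemma aasLocalizationLE_of_ballDiff {g : ℕ → ℝ} (hg : ∀ᶠ n in atTop, 1 ≤ c n / d n * g n) :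
    AASLocalizationLE p fun n => (Real.log (d n) + 2 * Real.log (Real.log n)) * g n :=
  aasLocalizationLE_of_distinguishing h.tendsto_d
    (h.eventually_rate_bounds.mono fun n hn => ⟨by linarith, by linarith⟩)
    (fun _ hη => h.eventually_mul_log_le tendsto_const_nhds hg hη)
    (fun _ hη hη1 => h.aas_distinguishing_ballDiff hη hη1)

lemma eventually_natCast_div_zpow : ∀ᶠ n : ℕ in atTop,
    0 < c n ∧ 0 < d n ∧ (n : ℝ) = d n ^ ((i n : ℤ) - 1) * (d n / c n) := by
  filter_upwards [h.eventually_regime (η := 1 / 30) (by norm_num) le_rfl] with n ⟨_, hr⟩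
  have hd := hr.d_pos
  have hc := hr.c_pos
  have hn := hr.n_pos
  refine ⟨hc, hd, ?_⟩
  rw [zpow_sub_one₀ hd.ne', zpow_natCast]
  have : d n ^ i n = c n * n := by rw [h.c_eq]; field_simp
  rw [this]
  field_simp

end

end GrowthAssumptions

/-! ### The critical window `c = log d - log log d + O(1)`. -/

section CriticalWindow

variable {d c : ℕ → ℝ} {B : ℝ}

lemma tendsto_log_log_div_log (hd : Tendsto d atTop atTop) :
    Tendsto (fun n => Real.log (Real.log (d n)) / Real.log (d n)) atTop (𝓝 0) :=
  Real.isLittleO_log_id_atTop.tendsto_div_nhds_zero.comp (Real.tendsto_log_atTop.comp hd)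

lemma tendsto_div_log_of_window (hd : Tendsto d atTop atTop)
    (hB : Tendsto (fun n => c n - (Real.log (d n) - Real.log (Real.log (d n)))) atTop (𝓝 B)) :
    Tendsto (fun n => c n / Real.log (d n)) atTop (𝓝 1) := by
  have hlog := Real.tendsto_log_atTop.comp hd
  have h1 := (hB.div_atTop hlog).add ((tendsto_log_log_div_log hd).const_sub 1)
  simp only [zero_add, sub_zero] at h1
  refine h1.congr' ?_
  filter_upwards [hlog.eventually_gt_atTop 0] with n hn
  simp only [Function.comp_apply] at hn ⊢
  field_simp
  ring

lemma tendsto_atTop_of_window (hd : Tendsto d atTop atTop)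
    (hB : Tendsto (fun n => c n - (Real.log (d n) - Real.log (Real.log (d n)))) atTop (𝓝 B)) :
    Tendsto c atTop atTop := by
  have hlog := Real.tendsto_log_atTop.comp hd
  refine ((tendsto_div_log_of_window hd hB).pos_mul_atTop one_pos hlog).congr' ?_
  filter_upwards [hlog.eventually_gt_atTop 0] with n hn
  simp only [Function.comp_apply] at hn ⊢
  field_simp

/-- Write `e^c c / d` as `e^{c - (log d - log log d)}` times `c / log d`. This is the limiting ratio
of the two terms of the rate, up to the factor `1 - e^{-c}`, which tends to 1. -/
lemma tendsto_exp_mul_div_of_window (hd : Tendsto d atTop atTop)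
    (hB : Tendsto (fun n => c n - (Real.log (d n) - Real.log (Real.log (d n)))) atTop (𝓝 B)) :
    Tendsto (fun n => Real.exp (c n) * (c n / d n)) atTop (𝓝 (Real.exp B)) := by
  have hlog := Real.tendsto_log_atTop.comp hd
  have h1 := ((Real.continuous_exp.tendsto B).comp hB).mul (tendsto_div_log_of_window hd hB)
  rw [mul_one] at h1
  refine h1.congr' ?_
  filter_upwards [hlog.eventually_gt_atTop 0, hd.eventually_gt_atTop 0] with n hn hd0
  simp only [Function.comp_apply] at hn ⊢
  rw [Real.exp_sub, Real.exp_sub, Real.exp_log hd0, Real.exp_log hn]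
  field_simp

end CriticalWindow

lemma GrowthAssumptions.of_le_log {p : ℕ → unitInterval} {i : ℕ → ℕ} {d c : ℕ → ℝ}
    (hd : ∀ n, d n = (p n : ℝ) * n) (hc : ∀ n, c n = d n ^ i n / n)
    (hd_lower : (fun n : ℕ => Real.log n ^ 3) =o[atTop] d)
    (hd_upper : d =o[atTop] fun n : ℕ => (n : ℝ)) (hd_top : Tendsto d atTop atTop)
    (hc_ge : ∃ c₀ > 0, ∀ᶠ n in atTop, c₀ ≤ c n)
    (hcd : ∀ᶠ n in atTop, c n ≤ Real.log (d n)) : GrowthAssumptions p i d c := by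
  refine ⟨hd, hc, hd_lower, hd_upper, hc_ge, ?_⟩
  filter_upwards [hcd, hd_top.eventually_ge_atTop 1] with n hn hd1
  have h1 : d n ≤ n := by
    rw [hd]; exact mul_le_of_le_one_left n.cast_nonneg (p n).2.2
  have h2 := Real.log_le_log (by linarith) h1
  have h3 := Real.log_nonneg (hd1.trans h1)
  linarith

lemma exp_mul_exp_neg (x y : ℝ) : Real.exp (-x) * y * Real.exp x = y := by
  rw [Real.exp_neg]; field_simp

end General

end LocalizationGame

end

/-! ### The four ranges of `c`. -/

open LocalizationGame in
theorem theorem6p2 (p : ℕ → unitInterval) (i : ℕ → ℕ) (d c : ℕ → ℝ)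
    (hd : ∀ n, d n = (p n : ℝ) * n)
    (hc : ∀ n, c n = d n ^ i n / n)
    (hd_lower : (fun n : ℕ => Real.log n ^ 3) =o[atTop] d)
    (hd_upper : d =o[atTop] fun n : ℕ => (n : ℝ)) :
    (∀ A : ℝ, 0 < A → Tendsto c atTop (𝓝 A) →
      LocalizationGame.AASLocalizationLE p fun n =>
        (Real.log (d n) + 2 * Real.log (Real.log n)) * (Real.exp A / (1 - Real.exp (-A)))) ∧
    (Tendsto c atTop atTop →
      Tendsto (fun n => c n - (Real.log (d n) - Real.log (Real.log (d n)))) atTop atBot →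
      LocalizationGame.AASLocalizationLE p fun n =>
        (Real.log (d n) + 2 * Real.log (Real.log n)) * Real.exp (c n)) ∧
    (∀ B : ℝ,
      Tendsto (fun n => c n - (Real.log (d n) - Real.log (Real.log (d n)))) atTop (𝓝 B) →
      (LocalizationGame.AASLocalizationLE p fun n =>
        (Real.log (d n) + 2 * Real.log (Real.log n)) * (Real.exp (c n) / (Real.exp B + 1))) ∧
      ((fun n => (Real.log (d n) + 2 * Real.log (Real.log n)) *
          (Real.exp (c n) / (Real.exp B + 1))) ~[atTop]
        fun n => (Real.log (d n) + 2 * Real.log (Real.log n)) *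
          (n / (d n ^ ((i n : ℤ) - 1) * (1 + Real.exp (-B))))) ∧
      (LocalizationGame.AASLocalizationLE p fun n =>
        (Real.log (d n) + 2 * Real.log (Real.log n)) *
          (n / (d n ^ ((i n : ℤ) - 1) * (1 + Real.exp (-B)))))) ∧
    (Tendsto (fun n => c n - (Real.log (d n) - Real.log (Real.log (d n)))) atTop atTop →
      (∀ᶠ n : ℕ in atTop, c n ≤ 3 * Real.log n) →
      LocalizationGame.AASLocalizationLE p fun n =>
        (Real.log (d n) + 2 * Real.log (Real.log n)) * (n / d n ^ ((i n : ℤ) - 1))) := by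
  have hd_top : Tendsto d atTop atTop := by
    refine tendsto_atTop_of_log_isLittleO (fun n => ?_) hd_lower
    rw [hd]; exact mul_nonneg (p n).2.1 n.cast_nonneg
  have hlog : Tendsto (fun n => Real.log (d n)) atTop atTop := Real.tendsto_log_atTop.comp hd_top
  have hloglog : Tendsto (fun n => Real.log (Real.log (d n))) atTop atTop :=
    Real.tendsto_log_atTop.comp hlog
  refine ⟨fun A hA hcA => ?_, fun hc_top hbot => ?_, fun B hB => ?_, fun htop hc3 => ?_⟩
  · have hcd : ∀ᶠ n in atTop, c n ≤ Real.log (d n) := by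
      filter_upwards [hcA.eventually (ge_mem_nhds (show A < A + 1 by linarith)),
        hlog.eventually_ge_atTop (A + 1)] with n h1 h2 using h1.trans h2
    have h := GrowthAssumptions.of_le_log hd hc hd_lower hd_upper hd_top
      ⟨A / 2, by positivity, hcA.eventually (le_mem_nhds (by linarith))⟩ hcd
    have hA1 : 0 < 1 - Real.exp (-A) := by
      have := Real.exp_lt_one_iff.2 (neg_lt_zero.2 hA); linarith
    have hlim : Tendsto (fun n => Real.exp (-c n) * (1 - Real.exp (-c n)) *
        (Real.exp A / (1 - Real.exp (-A)))) atTop (𝓝 1) := by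
      have h1 : Tendsto (fun n => Real.exp (-c n)) atTop (𝓝 (Real.exp (-A))) :=
        (Real.continuous_exp.tendsto _).comp hcA.neg
      have h2 := (h1.mul (h1.const_sub 1)).mul_const (Real.exp A / (1 - Real.exp (-A)))
      convert h2 using 2
      rw [← mul_div_assoc, exp_mul_exp_neg, div_self hA1.ne']
    refine h.aasLocalizationLE_of_le_log hcd hlim ?_
    -- For bounded `c` the contribution `c / d` is negligible and is dropped.
    filter_upwards [h.eventually_rate_bounds] with n hn
    have : 0 ≤ Real.exp A / (1 - Real.exp (-A)) := by positivity
    exact mul_le_mul_of_nonneg_right (by linarith) this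
  · have hcd : ∀ᶠ n in atTop, c n ≤ Real.log (d n) := by
      filter_upwards [hbot.eventually_le_atBot 0, hloglog.eventually_ge_atTop 0] with n h1 h2
      linarith
    have h := GrowthAssumptions.of_le_log hd hc hd_lower hd_upper hd_top
      ⟨1, one_pos, hc_top.eventually_ge_atTop 1⟩ hcd
    have h1 : Tendsto (fun n => 1 - Real.exp (-c n)) atTop (𝓝 1) := by
      simpa using (Real.tendsto_exp_neg_atTop_nhds_zero.comp hc_top).const_sub 1
    refine h.aasLocalizationLE_of_le_log hcd h1 ?_
    filter_upwards [h.eventually_rate_bounds] with n hn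
    rw [add_mul, exp_mul_exp_neg]
    have := mul_nonneg hn.1.1.le (Real.exp_pos (c n)).le
    linarith
  · have hcd : ∀ᶠ n in atTop, c n ≤ Real.log (d n) := by
      filter_upwards [hB.eventually (ge_mem_nhds (show B < B + 1 by linarith)),
        hloglog.eventually_ge_atTop (B + 1)] with n h1 h2
      linarith
    have hc_top := tendsto_atTop_of_window hd_top hB
    have h := GrowthAssumptions.of_le_log hd hc hd_lower hd_upper hd_top
      ⟨1, one_pos, hc_top.eventually_ge_atTop 1⟩ hcd
    have h1 : Tendsto (fun n => 1 - Real.exp (-c n)) atTop (𝓝 1) := by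
      simpa using (Real.tendsto_exp_neg_atTop_nhds_zero.comp hc_top).const_sub 1
    have h2 := tendsto_exp_mul_div_of_window hd_top hB
    have hB0 := Real.exp_pos B
    have hnB := Real.exp_neg B
    refine ⟨?_, ?_, ?_⟩
    · have hlim : Tendsto (fun n => ((1 - Real.exp (-c n)) + Real.exp (c n) * (c n / d n)) /
          (Real.exp B + 1)) atTop (𝓝 1) := by
        have h3 := (h1.add h2).div_const (Real.exp B + 1)
        rwa [add_comm 1, div_self (by positivity)] at h3
      refine h.aasLocalizationLE_of_le_log hcd hlim (Eventually.of_forall fun n => le_of_eq ?_)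
      rw [← mul_div_assoc (_ + _), add_mul (_ * _), exp_mul_exp_neg, mul_comm (c n / d n)]
    · refine IsEquivalent.mul IsEquivalent.refl (isEquivalent_of_tendsto_one ?_)
      have h3 := h2.mul_const ((1 + Real.exp (-B)) / (Real.exp B + 1))
      have h4 : Real.exp B * ((1 + Real.exp (-B)) / (Real.exp B + 1)) = 1 := by
        rw [hnB]; field_simp
      rw [h4] at h3
      refine h3.congr' ?_
      filter_upwards [h.eventually_natCast_div_zpow] with n ⟨hc0, hd0, hn⟩
      rw [Pi.div_apply, hn]
      have := zpow_pos hd0 ((i n : ℤ) - 1)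
      field_simp
    -- The second form of the bound is proved directly from the rate, with `n / d^{i-1} = d / c`,
    -- instead of being transferred along the equivalence.
    · have h3 : Tendsto (fun n => (Real.exp (c n) * (c n / d n))⁻¹) atTop
          (𝓝 (Real.exp B)⁻¹) := h2.inv₀ hB0.ne'
      have hlim : Tendsto (fun n => ((Real.exp (c n) * (c n / d n))⁻¹ * (1 - Real.exp (-c n)) + 1) /
          (1 + Real.exp (-B))) atTop (𝓝 1) := by
        have h4 := ((h3.mul h1).add_const 1).div_const (1 + Real.exp (-B))
        rwa [mul_one, ← hnB, add_comm _ (1 : ℝ), div_self (by positivity)] at h4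
      refine h.aasLocalizationLE_of_le_log hcd hlim ?_
      filter_upwards [h.eventually_natCast_div_zpow] with n ⟨hc0, hd0, hn⟩
      refine le_of_eq ?_
      have hz := zpow_pos hd0 ((i n : ℤ) - 1)
      have h5 : (n : ℝ) / (d n ^ ((i n : ℤ) - 1) * (1 + Real.exp (-B))) =
          d n / c n / (1 + Real.exp (-B)) := by
        conv_lhs => rw [hn]
        field_simp
      rw [h5, ← mul_div_assoc, Real.exp_neg (c n)]
      field_simp
  -- Here `c` may exceed `log d`, where the sphere estimate is not available; the balls of radius `i
  -- - 1` give the rate `c / d` alone.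
  · have hc1 : ∀ᶠ n in atTop, 1 ≤ c n := by
      filter_upwards [htop.eventually_ge_atTop 1, hlog.eventually_gt_atTop 0] with n h1 h2
      have := Real.log_le_sub_one_of_pos h2
      linarith
    have h : GrowthAssumptions p i d c :=
      ⟨hd, hc, hd_lower, hd_upper, ⟨1, one_pos, hc1⟩, hc3⟩
    refine h.aasLocalizationLE_of_ballDiff ?_
    filter_upwards [h.eventually_natCast_div_zpow] with n ⟨hc0, hd0, hn⟩
    refine le_of_eq ?_
    have hz := zpow_pos hd0 ((i n : ℤ) - 1)
    have h5 : (n : ℝ) / d n ^ ((i n : ℤ) - 1) = d n / c n := by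
      conv_lhs => rw [hn]
      field_simp
    rw [h5]
    field_simp
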